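/- Let $k\in\{1,2,\dots\}\cup\{\infty\}$, where $\mathbb N^k$ denotes the direct sum of $k$ copies of $\mathbb N$. A $k$-graph is a countable small category $\Lambda$ (identified with its set of morphisms, called paths, with range and source maps $r,s$) together with a functor $d:\Lambda\to\mathbb N^k$ having the factorization property: if $d(\mu)=n+m$, there are unique $\alpha,\beta$ with $d(\alpha)=n$, $d(\beta)=m$, $s(\alpha)=r(\beta)$, $\mu=\alpha\beta$. Write $\Lambda^0=d^{-1}(0)$ for the vertices and $v\Lambda^n=\{\mu: r(\mu)=v,\ d(\mu)=n\}$. All $k$-graphs are assumed row-finite and without sources, i.e. $v\Lambda^n$ is finite and nonempty for all $v\in\Lambda^0$, $n\in\mathbb N^k$. A Cuntz--Krieger $\Lambda$-family in a C*-algebra is a family of partial isometries $(S_\mu)_{\mu\in\Lambda}$ such that the $S_v$ ($v\in\Lambda^0$) are mutually orthogonal projections, $S_{\mu\nu}=S_\mu S_\nu$ if $s(\mu)=r(\nu)$, $S_\mu^*S_\mu=S_{s(\mu)}$, and $S_v=\sum_{\mu\in v\Lambda^n}S_\mu S_\mu^*$ for all $v\in\Lambda^0$, $n\in\mathbb N^k$.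 The $k$-graph C*-algebra $\mathcal O_\Lambda$ is the C*-algebra generated by a universal Cuntz--Krieger $\Lambda$-family $(t_\mu)$. Let a countable discrete group $G$ act on the set $\Lambda$ by bijections preserving $d$ and commuting with $r$ and $s$, and suppose that the action is self-similar, i.e. equipped with a restriction map $G\times\Lambda\to G$, $(g,\mu)\mapsto g|_\mu$, such that, for all $g,h\in G$, $\mu,\nu\in\Lambda$ with $s(\mu)=r(\nu)$, and $v\in\Lambda^0$: $g\cdot(\mu\nu)=(g\cdot\mu)(g|_\mu\cdot\nu)$ (the right-hand product being defined), $g|_v=g$, $g|_{\mu\nu}=(g|_\mu)|_\nu$, $1_G|_\mu=1_G$, and $(gh)|_\mu=g|_{h\cdot\mu}\,h|_\mu$. Assume that $\Lambda^0$ is finite. Let $\mathcal O_{G,\Lambda}$ be the universal unital C*-algebra generated by unitaries $(u_g)_{g\in G}$ and a Cuntz--Krieger $\Lambda$-family $(s_\mu)_{\mu\in\Lambda}$ with $\sum_{v\in\Lambda^0}s_v=1$, subject to $u_{gh}=u_gu_h$ and $u_gs_\mu=s_{g\cdot\mu}u_{g|_\mu}$ for all $g,h\in G$, $\mu\in\Lambda$.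 Then there is a unique $*$-homomorphism $\iota:\mathcal O_\Lambda\to\mathcal O_{G,\Lambda}$ with $\iota(t_\mu)=s_\mu$ for all $\mu\in\Lambda$, and $\iota$ is injective. -/

import Mathlib

open scoped ENNReal

universe u

noncomputable section

/-! ### `k`-graphs, `k ∈ {1, 2, …, ∞}` -/

/-- The degree monoid `ℕ^k`, for `k` a natural number or `∞`.  For finite `k` this is the usual
`ℕ^k`; for `k = ∞` it is the direct sum of countably many copies of `ℕ`. -/
abbrev KDegree (k : ℕ∞) : Type := {i : ℕ // (i : ℕ∞) < k} →₀ ℕ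

/-- A `k`-graph, as a countable small category in the "arrows only" presentation: objects are
identified with their identity morphisms, so `r` and `s` map a path to a path (a vertex).
`comp μ ν` is the composition `μν`; it is meaningful only if `s μ = r ν`, and its values at other
pairs are unconstrained and never used. -/
structure KGraph (k : ℕ∞) where
  /-- the morphisms (paths) of the category -/
  Path : Type u
  countable : Countable Path
  /-- range (codomain) -/
  r : Path → Path
  /-- source (domain) -/
  s : Path → Path
  /-- composition -/
  comp : Path → Path → Path
  r_r : ∀ μ, r (r μ) = r μ
  s_r : ∀ μ, s (r μ) = r μ
  r_s : ∀ μ, r (s μ) = s μ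
  s_s : ∀ μ, s (s μ) = s μ
  r_comp : ∀ μ ν, s μ = r ν → r (comp μ ν) = r μ
  s_comp : ∀ μ ν, s μ = r ν → s (comp μ ν) = s ν
  id_comp : ∀ μ, comp (r μ) μ = μ
  comp_id : ∀ μ, comp μ (s μ) = μ
  assoc : ∀ μ ν ξ, s μ = r ν → s ν = r ξ → comp (comp μ ν) ξ = comp μ (comp ν ξ)
  /-- the degree functor -/
  d : Path → KDegree k
  d_id : ∀ μ, d (r μ) = 0
  d_comp : ∀ μ ν, s μ = r ν → d (comp μ ν) = d μ + d ν
  /-- the factorization property -/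
  factorization : ∀ (μ : Path) (n m : KDegree k), d μ = n + m →
    ∃! p : Path × Path, d p.1 = n ∧ d p.2 = m ∧ s p.1 = r p.2 ∧ comp p.1 p.2 = μ

namespace KGraph

variable {k : ℕ∞}

/-- The set of vertices `Λ⁰ = d⁻¹(0)`; it is the set of identity morphisms. -/
def vertices (Λ : KGraph.{u} k) : Set Λ.Path := {v | Λ.d v = 0}

/-- `v Λⁿ`, the set of paths of degree `n` with range `v`. -/
def pathsTo (Λ : KGraph.{u} k) (v : Λ.Path) (n : KDegree k) : Set Λ.Path :=
  {μ | Λ.r μ = v ∧ Λ.d μ = n}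

/-- `Λ` is row-finite. -/
def RowFinite (Λ : KGraph.{u} k) : Prop :=
  ∀ v ∈ Λ.vertices, ∀ n, (Λ.pathsTo v n).Finite

/-- `Λ` has no sources. -/
def NoSources (Λ : KGraph.{u} k) : Prop :=
  ∀ v ∈ Λ.vertices, ∀ n, (Λ.pathsTo v n).Nonempty

end KGraph

/-- A Cuntz-Krieger `Λ`-family in a C*-algebra `B`, for a row-finite `k`-graph `Λ`.
Row-finiteness makes the sum in the last clause finite. -/
structure IsCuntzKriegerFamily {k : ℕ∞} (Λ : KGraph.{u} k) {B : Type*}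
    [NonUnitalCStarAlgebra B] (S : Λ.Path → B) : Prop where
  partialIsometry : ∀ μ, S μ * star (S μ) * S μ = S μ
  projection : ∀ v ∈ Λ.vertices, IsStarProjection (S v)
  orthogonal : ∀ v ∈ Λ.vertices, ∀ w ∈ Λ.vertices, v ≠ w → S v * S w = 0
  mul : ∀ μ ν, Λ.s μ = Λ.r ν → S (Λ.comp μ ν) = S μ * S ν
  star_mul_self : ∀ μ, star (S μ) * S μ = S (Λ.s μ)
  cuntzKrieger : ∀ v ∈ Λ.vertices, ∀ n, S v = ∑ᶠ μ ∈ Λ.pathsTo v n, S μ * star (S μ)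

/-! ### Self-similar actions -/

/-- A self-similar action of a group `G` on a `k`-graph `Λ`, with its restriction map:
`act g μ = g · μ` and `restr g μ = g|_μ`. -/
structure SelfSimilarAction {k : ℕ∞} (G : Type u) [Group G] (Λ : KGraph.{u} k) where
  /-- the action, a homomorphism from `G` to the bijections of `Λ` -/
  act : G →* Equiv.Perm Λ.Path
  d_act : ∀ g μ, Λ.d (act g μ) = Λ.d μ
  s_act : ∀ g μ, Λ.s (act g μ) = act g (Λ.s μ)
  r_act : ∀ g μ, Λ.r (act g μ) = act g (Λ.r μ)
  /-- the restriction map -/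
  restr : G → Λ.Path → G
  /-- the product on the right-hand side of `act_comp` is defined -/
  composable : ∀ g μ ν, Λ.s μ = Λ.r ν → Λ.s (act g μ) = Λ.r (act (restr g μ) ν)
  act_comp : ∀ g μ ν, Λ.s μ = Λ.r ν →
    act g (Λ.comp μ ν) = Λ.comp (act g μ) (act (restr g μ) ν)
  restr_vertex : ∀ g, ∀ v ∈ Λ.vertices, restr g v = g
  restr_comp : ∀ g μ ν, Λ.s μ = Λ.r ν → restr g (Λ.comp μ ν) = restr (restr g μ) ν
  one_restr : ∀ μ, restr 1 μ = 1
  mul_restr : ∀ g h μ, restr (g * h) μ = restr g (act h μ) * restr h μ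

/-- A pair `(U, S)` in a unital C*-algebra `B` as in the definition of `O_{G,Λ}`: a unitary
representation `U` of `G` and a (nondegenerate, i.e. `∑_{v ∈ Λ⁰} S_v = 1`) Cuntz-Krieger
`Λ`-family `S` with `U_g S_μ = S_{g·μ} U_{g|_μ}`.  It is used for finite `Λ⁰` only. -/
structure IsSelfSimilarFamily {k : ℕ∞} {G : Type u} [Group G] {Λ : KGraph.{u} k}
    (a : SelfSimilarAction G Λ) {B : Type*} [CStarAlgebra B]
    (U : G → B) (S : Λ.Path → B) : Prop where
  cuntzKrieger : IsCuntzKriegerFamily Λ S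
  sum_vertices : ∑ᶠ v ∈ Λ.vertices, S v = 1
  unitary : ∀ g, U g ∈ unitary B
  mul : ∀ g h, U (g * h) = U g * U h
  covariant : ∀ g μ, U g * S μ = S (a.act g μ) * U (a.restr g μ)

/-! ### The C*-algebra generated by a product of families of contractions -/

namespace ProductFamily

variable {I X : Type*} {A : I → Type*} [∀ i, NonUnitalCStarAlgebra (A i)]

/-- The family `x ↦ (f i x)_i` in the C*-algebra `∏ᵢ A i` of bounded families. -/
def family (f : ∀ i, X → A i) (hf : ∀ i x, ‖f i x‖ ≤ 1) (x : X) : lp A ∞ :=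
  ⟨fun i => f i x, memℓp_infty ⟨1, by rintro _ ⟨i, rfl⟩; exact hf i x⟩⟩

/-- The C*-subalgebra of `∏ᵢ A i` generated by the family. -/
def algebra (f : ∀ i, X → A i) (hf : ∀ i x, ‖f i x‖ ≤ 1) :
    NonUnitalStarSubalgebra ℂ (lp A ∞) :=
  (NonUnitalStarAlgebra.adjoin ℂ (Set.range (family f hf))).topologicalClosure

variable (f : ∀ i, X → A i) (hf : ∀ i x, ‖f i x‖ ≤ 1)

/-- The generators, as elements of the generated C*-algebra. -/
def gen (x : X) : algebra f hf :=
  ⟨family f hf x, NonUnitalStarSubalgebra.le_topologicalClosure _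
    (NonUnitalStarAlgebra.subset_adjoin ℂ _ ⟨x, rfl⟩)⟩

instance : NonUnitalCStarAlgebra (algebra f hf) :=
  NonUnitalStarSubalgebra.nonUnitalCStarAlgebra _
    (h_closed := NonUnitalStarSubalgebra.isClosed_topologicalClosure _)

/-- The `i`-th coordinate. -/
def eval (i : I) : algebra f hf →⋆ₙₐ[ℂ] A i where
  toFun a := (a : lp A ∞) i
  map_smul' _ _ := rfl
  map_zero' := rfl
  map_add' _ _ := rfl
  map_mul' _ _ := rfl
  map_star' _ := rfl

theorem eval_gen (i : I) (x : X) : eval f hf i (gen f hf x) = f i x := rfl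

variable {f hf}

theorem ext_eval {a b : algebra f hf} (h : ∀ i, eval f hf i a = eval f hf i b) : a = b :=
  Subtype.ext (lp.ext (funext h))

theorem hom_ext {B : Type*} [NonUnitalCStarAlgebra B] {φ ψ : algebra f hf →⋆ₙₐ[ℂ] B}
    (h : ∀ x, φ (gen f hf x) = ψ (gen f hf x)) : φ = ψ := by
  have hφ : Continuous φ := (NonUnitalStarAlgHom.instContinuousLinearMapClassComplex
    (F := algebra f hf →⋆ₙₐ[ℂ] B)).map_continuous φ
  have hψ : Continuous ψ := (NonUnitalStarAlgHom.instContinuousLinearMapClassComplex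
    (F := algebra f hf →⋆ₙₐ[ℂ] B)).map_continuous ψ
  have key : ∀ (y : lp A ∞) (hy : y ∈ NonUnitalStarAlgebra.adjoin ℂ (Set.range (family f hf))),
      φ ⟨y, NonUnitalStarSubalgebra.le_topologicalClosure _ hy⟩ =
        ψ ⟨y, NonUnitalStarSubalgebra.le_topologicalClosure _ hy⟩ := by
    intro y hy
    induction hy using NonUnitalStarAlgebra.adjoin_induction with
    | mem z hz => obtain ⟨x, rfl⟩ := hz; exact h x
    | zero => exact (map_zero φ).trans (map_zero ψ).symm
    | add y z hy hz h1 h2 =>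
      have := congrArg₂ (· + ·) h1 h2
      simp only [← map_add] at this
      exact this
    | mul y z hy hz h1 h2 =>
      have := congrArg₂ (· * ·) h1 h2
      simp only [← map_mul] at this
      exact this
    | smul c y hy h1 =>
      have := congrArg (c • ·) h1
      simp only [← map_smul] at this
      exact this
    | star y hy h1 =>
      have := congrArg star h1
      simp only [← map_star] at this
      exact this
  ext ⟨a, ha⟩
  have hcl : IsClosed {x : algebra f hf | φ x = ψ x} := isClosed_eq hφ hψ
  have hd : (⟨a, ha⟩ : algebra f hf) ∈ closure {x : algebra f hf | φ x = ψ x} := by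
    rw [closure_subtype]
    refine closure_mono ?_ ha
    intro y hy
    exact ⟨⟨y, NonUnitalStarSubalgebra.le_topologicalClosure _ hy⟩, key y hy, rfl⟩
  exact hcl.closure_subset hd

end ProductFamily

/-! ### The `k`-graph C*-algebra `O_Λ` -/

namespace KGraph

variable {k : ℕ∞} (Λ : KGraph.{u} k)

/-- All Cuntz-Krieger `Λ`-families in C*-algebras.  Since `Λ` is countable, such a family
generates a separable C*-algebra, which has at most continuum many elements and hence an
isomorphic copy in `Type u`; so nothing is lost by fixing the universe. -/
structure CKFamily : Type (u + 1) where
  B : Type u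
  [inst : NonUnitalCStarAlgebra B]
  S : Λ.Path → B
  isCK : IsCuntzKriegerFamily Λ S

attribute [instance] CKFamily.inst

end KGraph

theorem IsCuntzKriegerFamily.norm_le_one {k : ℕ∞} {Λ : KGraph.{u} k} {B : Type*}
    [NonUnitalCStarAlgebra B] {S : Λ.Path → B} (h : IsCuntzKriegerFamily Λ S) (μ : Λ.Path) :
    ‖S μ‖ ≤ 1 := by
  have h0 : Λ.s μ ∈ Λ.vertices := by
    have := Λ.d_id (Λ.s μ)
    rwa [Λ.r_s] at this
  have h1 := (h.projection _ h0).norm_le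
  rw [← h.star_mul_self, CStarRing.norm_star_mul_self] at h1
  nlinarith [norm_nonneg (S μ)]

namespace KGraph

variable {k : ℕ∞} (Λ : KGraph.{u} k)

/-- The `k`-graph C*-algebra `O_Λ`: the C*-algebra generated by the universal Cuntz-Krieger
`Λ`-family, realised as the product of all Cuntz-Krieger `Λ`-families. -/
def CKAlgebra : Type (u + 1) :=
  ProductFamily.algebra (fun i : Λ.CKFamily => i.S) (fun i => i.isCK.norm_le_one)

instance : NonUnitalCStarAlgebra Λ.CKAlgebra :=
  inferInstanceAs (NonUnitalCStarAlgebra (ProductFamily.algebra _ _))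

/-- The universal Cuntz-Krieger `Λ`-family `s_μ` in `O_Λ`. -/
def ckGen (μ : Λ.Path) : Λ.CKAlgebra :=
  ProductFamily.gen (fun i : Λ.CKFamily => i.S) (fun i => i.isCK.norm_le_one) μ

/-- A family in a product of C*-algebras is Cuntz-Krieger if all its coordinates are. -/
theorem isCK_of_eval (hΛ : Λ.RowFinite) {I : Type*} {A : I → Type*} {B : Type*}
    [∀ i, NonUnitalCStarAlgebra (A i)] [NonUnitalCStarAlgebra B]
    (e : ∀ i, B →⋆ₙₐ[ℂ] A i) (he : ∀ a b : B, (∀ i, e i a = e i b) → a = b)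
    (S : Λ.Path → B) (h : ∀ i, IsCuntzKriegerFamily Λ fun μ => e i (S μ)) :
    IsCuntzKriegerFamily Λ S where
  partialIsometry μ := he _ _ fun i => by
    simpa only [map_mul, map_star] using (h i).partialIsometry μ
  projection v hv :=
    ⟨he _ _ fun i => by
        simpa only [map_mul] using ((h i).projection v hv).isIdempotentElem.eq,
      he _ _ fun i => by
        simpa only [map_star] using ((h i).projection v hv).isSelfAdjoint.star_eq⟩
  orthogonal v hv w hw hvw := he _ _ fun i => by
    simpa only [map_mul, map_zero] using (h i).orthogonal v hv w hw hvw
  mul μ ν hμν := he _ _ fun i => by simpa only [map_mul] using (h i).mul μ ν hμν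
  star_mul_self μ := he _ _ fun i => by
    simpa only [map_mul, map_star] using (h i).star_mul_self μ
  cuntzKrieger v hv n := he _ _ fun i => by
    have := (h i).cuntzKrieger v hv n
    rw [finsum_mem_eq_finite_toFinset_sum _ (hΛ v hv n)] at this ⊢
    simpa only [map_sum, map_mul, map_star] using this

/-- The generators of `O_Λ` form a Cuntz-Krieger family. -/
theorem isCK_ckGen (hΛ : Λ.RowFinite) : IsCuntzKriegerFamily Λ Λ.ckGen :=
  Λ.isCK_of_eval hΛ
    (ProductFamily.eval (fun i : Λ.CKFamily => i.S) (fun i => i.isCK.norm_le_one))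
    (fun _ _ => ProductFamily.ext_eval) _ fun i => i.isCK

/-- The universal property of `O_Λ`. -/
theorem existsUnique_ckLift {B : Type u} [NonUnitalCStarAlgebra B] {S : Λ.Path → B}
    (hS : IsCuntzKriegerFamily Λ S) :
    ∃! φ : Λ.CKAlgebra →⋆ₙₐ[ℂ] B, ∀ μ, φ (Λ.ckGen μ) = S μ :=
  ⟨ProductFamily.eval (fun i : Λ.CKFamily => i.S) (fun i => i.isCK.norm_le_one) ⟨B, S, hS⟩,
    fun _ => rfl, fun _ hψ => ProductFamily.hom_ext hψ⟩

end KGraph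

/-! ### The self-similar `k`-graph C*-algebra `O_{G,Λ}` -/

theorem IsSelfSimilarFamily.norm_le_one {k : ℕ∞} {G : Type u} [Group G] {Λ : KGraph.{u} k}
    {a : SelfSimilarAction G Λ} {B : Type*} [CStarAlgebra B] {U : G → B} {S : Λ.Path → B}
    (h : IsSelfSimilarFamily a U S) (x : G ⊕ Λ.Path) : ‖Sum.elim U S x‖ ≤ 1 := by
  rcases x with g | μ
  · rcases subsingleton_or_nontrivial B with hB | hB
    · rw [Subsingleton.elim (Sum.elim U S (Sum.inl g)) 0, norm_zero]
      exact zero_le_one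
    · exact (CStarRing.norm_of_mem_unitary (h.unitary g)).le
  · exact h.cuntzKrieger.norm_le_one μ

theorem IsSelfSimilarFamily.map_one {k : ℕ∞} {G : Type u} [Group G] {Λ : KGraph.{u} k}
    {a : SelfSimilarAction G Λ} {B : Type*} [CStarAlgebra B] {U : G → B} {S : Λ.Path → B}
    (h : IsSelfSimilarFamily a U S) : U 1 = 1 := by
  have h1 := h.mul 1 1
  rw [mul_one] at h1
  have h2 := congrArg (star (U 1) * ·) h1
  simpa [← mul_assoc, Unitary.star_mul_self_of_mem (h.unitary 1)] using h2.symm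

namespace SelfSimilarAction

variable {k : ℕ∞} {G : Type u} [Group G] {Λ : KGraph.{u} k} (a : SelfSimilarAction G Λ)

/-- All pairs `(U, S)` as in `IsSelfSimilarFamily`.  Since `G` and `Λ` are countable, nothing is
lost by fixing the universe. -/
structure Family : Type (u + 1) where
  B : Type u
  [inst : CStarAlgebra B]
  U : G → B
  S : Λ.Path → B
  isFamily : IsSelfSimilarFamily a U S

attribute [instance] Family.inst

/-- The self-similar `k`-graph C*-algebra `O_{G,Λ}` (for finite `Λ⁰`): the C*-algebra generated
by the universal pair `(u, s)`, realised as the product of all such pairs. -/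
def UnivAlgebra : Type (u + 1) :=
  ProductFamily.algebra (fun i : a.Family => Sum.elim i.U i.S)
    (fun i => i.isFamily.norm_le_one)

/-- The universal unitaries `u_g` in `O_{G,Λ}`. -/
def uGen (g : G) : a.UnivAlgebra :=
  ProductFamily.gen (fun i : a.Family => Sum.elim i.U i.S)
    (fun i => i.isFamily.norm_le_one) (Sum.inl g)

/-- The universal Cuntz-Krieger `Λ`-family `s_μ` in `O_{G,Λ}`. -/
def sGen (μ : Λ.Path) : a.UnivAlgebra :=
  ProductFamily.gen (fun i : a.Family => Sum.elim i.U i.S)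
    (fun i => i.isFamily.norm_le_one) (Sum.inr μ)

/-- `O_{G,Λ}` is a unital C*-algebra, with unit `u_1`. -/
instance : CStarAlgebra a.UnivAlgebra :=
  letI inst : NonUnitalCStarAlgebra a.UnivAlgebra :=
    inferInstanceAs (NonUnitalCStarAlgebra (ProductFamily.algebra _ _))
  have h1 : ∀ x : a.UnivAlgebra, a.uGen 1 * x = x := fun x => ProductFamily.ext_eval fun i => by
    refine (congrArg (· * _) (i.isFamily.map_one)).trans (one_mul _)
  have h2 : ∀ x : a.UnivAlgebra, x * a.uGen 1 = x := fun x => ProductFamily.ext_eval fun i => by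
    refine (congrArg (_ * ·) (i.isFamily.map_one)).trans (mul_one _)
  letI ring : NormedRing a.UnivAlgebra :=
    { inst.toNonUnitalNormedRing with
      one := a.uGen 1
      one_mul := h1
      mul_one := h2 }
  letI alg : Algebra ℂ a.UnivAlgebra :=
    Algebra.ofModule (fun c x y => smul_mul_assoc c x y)
      (fun c x y => mul_smul_comm c x y)
  { inst, ring, alg with
    norm_smul_le := inst.toNormedSpace.norm_smul_le }

/-- Coordinates of `O_{G,Λ}`. -/
def eval (i : a.Family) : a.UnivAlgebra →⋆ₐ[ℂ] i.B where
  toFun := ProductFamily.eval (fun i : a.Family => Sum.elim i.U i.S)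
    (fun i => i.isFamily.norm_le_one) i
  map_one' := i.isFamily.map_one
  map_zero' := rfl
  map_add' _ _ := rfl
  map_mul' _ _ := rfl
  map_star' _ := rfl
  commutes' c := by
    rw [Algebra.algebraMap_eq_smul_one, Algebra.algebraMap_eq_smul_one]
    exact congrArg (c • ·) i.isFamily.map_one

/-- The generators of `O_{G,Λ}` satisfy the defining relations. -/
theorem isSelfSimilarFamily_gen (hΛ : Λ.RowFinite) (hfin : Λ.vertices.Finite) :
    IsSelfSimilarFamily a a.uGen a.sGen where
  cuntzKrieger := Λ.isCK_of_eval hΛ (fun i => (a.eval i : a.UnivAlgebra →⋆ₙₐ[ℂ] i.B))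
    (fun _ _ => ProductFamily.ext_eval) _ fun i => i.isFamily.cuntzKrieger
  sum_vertices := ProductFamily.ext_eval fun i => by
    change a.eval i _ = a.eval i 1
    have := i.isFamily.sum_vertices
    rw [finsum_mem_eq_finite_toFinset_sum _ hfin] at this ⊢
    rw [map_sum, map_one]
    exact this
  unitary g :=
    ⟨ProductFamily.ext_eval fun i => (Unitary.star_mul_self_of_mem (i.isFamily.unitary g)).trans
        i.isFamily.map_one.symm,
      ProductFamily.ext_eval fun i => (Unitary.mul_star_self_of_mem (i.isFamily.unitary g)).trans
        i.isFamily.map_one.symm⟩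
  mul g h := ProductFamily.ext_eval fun i => i.isFamily.mul g h
  covariant g μ := ProductFamily.ext_eval fun i => i.isFamily.covariant g μ

/-- The universal property of `O_{G,Λ}`. -/
theorem existsUnique_lift {B : Type u} [CStarAlgebra B] {U : G → B} {S : Λ.Path → B}
    (h : IsSelfSimilarFamily a U S) :
    ∃! φ : a.UnivAlgebra →⋆ₐ[ℂ] B, (∀ g, φ (a.uGen g) = U g) ∧ ∀ μ, φ (a.sGen μ) = S μ := by
  refine ⟨a.eval ⟨B, U, S, h⟩, ⟨fun _ => rfl, fun _ => rfl⟩, fun ψ hψ => ?_⟩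
  have key : (ψ : a.UnivAlgebra →⋆ₙₐ[ℂ] B) = (a.eval ⟨B, U, S, h⟩ : a.UnivAlgebra →⋆ₙₐ[ℂ] B) :=
    ProductFamily.hom_ext (by
      rintro (g | μ)
      · exact hψ.1 g
      · exact hψ.2 μ)
  ext x
  exact DFunLike.congr_fun key x

end SelfSimilarAction

end

/-!
The map `ι : O_Λ → O_{G,Λ}` exists and is unique by the universal property of `O_Λ`. Its
injectivity is an instance of the gauge-invariant uniqueness theorem for `k`-graphs
(`IsCuntzKriegerFamily.injective_of_gauge_invariant`), which needs two inputs.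

* *The kernel of `ι` is gauge-invariant.* The self-similar action preserves degrees, so
  multiplying each `s_μ` by `z^{d(μ)}`, with `z` in the torus `𝕋^k`, and keeping the `u_g`, preserves
  the relations of `O_{G,Λ}`. Hence `O_{G,Λ}` carries a gauge action, and `ι` is equivariant.
* *No vertex projection of `O_{G,Λ}` vanishes.* The group acts on the space `Λ^∞` of infinite paths
  through their initial segments, and the operators `U_g δ_x = δ_{g x}` and `S_μ δ_x = δ_{μ x}` on
  `ℓ²(Λ^∞)` satisfy the relations, because `g (μ x) = (g · μ) (g|_μ x)`. By compactness each vertex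
  is the range of an infinite path, so `S_v ≠ 0`. Different group elements may agree on paths; this
  does no harm, as only the vertex projections matter.

For the uniqueness theorem, the elements `t_μ t_ν⋆` span a dense `*`-subalgebra of `O_Λ`. Averaging
over the gauge action (Haar measure on the compact group `𝕋^k`, also for `k = ∞`) kills those with
`d μ ≠ d ν` and keeps the others. For fixed `n`, the `t_μ t_ν⋆` with `d μ = d ν = n` span a
finite-dimensional C*-algebra `levelAlgebra`, in which they behave as matrix units; these algebras
increase with `n`, and a homomorphism that kills no `t_v` is injective, hence isometric, on each of
them. It is therefore isometric on all averages. If it kills `a`, and its kernel is gauge-invariant,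
it kills the average of `a⋆ a`; so this average is zero, and positivity and continuity of the gauge
action give `a = 0`.
-/

noncomputable section

/-! ### Positivity in C*-algebras -/

section Positivity

open scoped CStarAlgebra
open MeasureTheory CStarAlgebra

variable {A : Type*} [NonUnitalCStarAlgebra A]

attribute [local instance] CStarAlgebra.spectralOrder CStarAlgebra.spectralOrderedRing

/-- Projections whose sum acts as a left unit on each of them are mutually orthogonal: compressing
the sum by `p i` shows that the positive elements `(p j * p i)⋆ * (p j * p i)` with `j ≠ i` add up
to zero. -/
theorem IsStarProjection.mul_eq_zero_of_sum_mul {ι : Type*} [DecidableEq ι] {t : Finset ι}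
    {p : ι → A} (hp : ∀ i ∈ t, IsStarProjection (p i))
    (hs : ∀ i ∈ t, (∑ j ∈ t, p j) * p i = p i) {i j : ι} (hi : i ∈ t) (hj : j ∈ t)
    (hij : j ≠ i) : p j * p i = 0 := by
  have hsq : ∀ j ∈ t, star (p j * p i) * (p j * p i) = p i * p j * p i := by
    intro j hj
    rw [star_mul, (hp j hj).isSelfAdjoint.star_eq, (hp i hi).isSelfAdjoint.star_eq,
      mul_assoc, ← mul_assoc (p j), (hp j hj).isIdempotentElem.eq, mul_assoc]
  have h1 : ∑ j ∈ t, p i * p j * p i = p i := by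
    rw [← Finset.sum_mul, ← Finset.mul_sum, mul_assoc, hs i hi, (hp i hi).isIdempotentElem.eq]
  have h2 : ∑ j ∈ t.erase i, star (p j * p i) * (p j * p i) = 0 := by
    rw [← Finset.add_sum_erase t _ hi, (hp i hi).isIdempotentElem.eq,
      (hp i hi).isIdempotentElem.eq] at h1
    rw [← add_eq_left.mp h1]
    exact Finset.sum_congr rfl fun j hj => hsq j (Finset.mem_of_mem_erase hj)
  have h3 := (Finset.sum_eq_zero_iff_of_nonneg fun j _ => star_mul_self_nonneg (p j * p i)).mp h2 j
    (Finset.mem_erase.mpr ⟨hij, hj⟩)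
  exact (CStarRing.star_mul_self_eq_zero_iff _).mp h3

/-- A continuous function with values of the form `g⋆ * g` and vanishing integral vanishes. -/
theorem eq_zero_of_integral_star_mul_self_eq_zero {T : Type*} [TopologicalSpace T]
    [CompactSpace T] [MeasurableSpace T] [BorelSpace T] {μ : Measure T} [IsFiniteMeasure μ]
    [μ.IsOpenPosMeasure] {f : T → A} (hf : Continuous f) (hpos : ∀ z, ∃ g : A, f z = star g * g)
    (hint : ∫ z, f z ∂μ = 0) (z₀ : T) : f z₀ = 0 := by
  have hnn : ∀ z, 0 ≤ f z := fun z => by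
    obtain ⟨g, hg⟩ := hpos z
    rw [hg]
    exact star_mul_self_nonneg g
  have hfi : Integrable f μ :=
    hf.integrable_of_hasCompactSupport (HasCompactSupport.of_compactSpace f)
  rw [← norm_eq_zero]
  refine le_antisymm (le_of_forall_pos_le_add fun ε hε => ?_) (norm_nonneg _)
  rw [zero_add]
  set V : Set T := {z | ‖f z₀ - f z‖ < ε}
  have hV : IsOpen V := isOpen_lt (by fun_prop) continuous_const
  have hz : z₀ ∈ V := by simpa [V] using hε
  have hVpos : 0 < μ.real V :=
    ENNReal.toReal_pos (hV.measure_pos μ ⟨z₀, hz⟩).ne' (measure_ne_top μ V)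
  -- Both parts of the integral are positive, so the integral over `V` vanishes as well.
  have hV0 : ∫ z in V, f z ∂μ = 0 := by
    have h1 : 0 ≤ ∫ z in V, f z ∂μ := integral_nonneg hnn
    have h2 : 0 ≤ ∫ z in Vᶜ, f z ∂μ := integral_nonneg hnn
    have h3 := integral_add_compl hV.measurableSet hfi
    rw [hint] at h3
    exact le_antisymm (by rw [← h3]; exact le_add_of_nonneg_right h2) h1
  have h4 : ∫ z in V, (f z₀ - f z) ∂μ = μ.real V • f z₀ := by
    rw [integral_sub (integrable_const _) hfi.integrableOn, hV0, sub_zero, setIntegral_const]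
  have h5 : ‖∫ z in V, (f z₀ - f z) ∂μ‖ ≤ ε * μ.real V :=
    norm_setIntegral_le_of_norm_le_const (measure_lt_top μ V) fun z hz => le_of_lt hz
  rw [h4, norm_smul, Real.norm_of_nonneg hVpos.le, mul_comm ε] at h5
  exact le_of_mul_le_mul_left h5 hVpos

end Positivity

/-! ### Paths in a `k`-graph -/

namespace KGraph

variable {k : ℕ∞} (Λ : KGraph.{u} k)

theorem r_mem_vertices (μ : Λ.Path) : Λ.r μ ∈ Λ.vertices := Λ.d_id μ

theorem s_mem_vertices (μ : Λ.Path) : Λ.s μ ∈ Λ.vertices := by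
  have := Λ.d_id (Λ.s μ)
  rwa [Λ.r_s] at this

variable {Λ}

theorem comp_cancel {α β α' β' : Λ.Path} (h : Λ.s α = Λ.r β) (h' : Λ.s α' = Λ.r β')
    (hd : Λ.d α = Λ.d α') (he : Λ.comp α β = Λ.comp α' β') : α = α' ∧ β = β' := by
  have hdβ : Λ.d β = Λ.d β' := by
    have h1 := Λ.d_comp α β h
    rw [he, Λ.d_comp _ _ h', hd] at h1
    exact (add_left_cancel h1).symm
  have := (Λ.factorization (Λ.comp α β) _ _ (Λ.d_comp α β h)).unique
    (y₁ := (α, β)) (y₂ := (α', β')) ⟨rfl, rfl, h, rfl⟩ ⟨hd.symm, hdβ.symm, h', he.symm⟩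
  exact ⟨congrArg Prod.fst this, congrArg Prod.snd this⟩

theorem exists_comp_eq {μ : Λ.Path} {n m : KDegree k} (h : Λ.d μ = n + m) :
    ∃ α β, Λ.d α = n ∧ Λ.d β = m ∧ Λ.s α = Λ.r β ∧ Λ.comp α β = μ := by
  obtain ⟨⟨α, β⟩, hp, -⟩ := Λ.factorization μ n m h
  exact ⟨α, β, hp⟩

theorem r_eq_self {v : Λ.Path} (hv : v ∈ Λ.vertices) : Λ.r v = v :=
  (comp_cancel (α := Λ.r v) (β := v) (α' := v) (β' := Λ.s v) (Λ.s_r v) (Λ.r_s v).symm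
    ((Λ.d_id v).trans hv.symm) ((Λ.id_comp v).trans (Λ.comp_id v).symm)).1

theorem s_eq_self {v : Λ.Path} (hv : v ∈ Λ.vertices) : Λ.s v = v := by
  have := Λ.s_r v
  rwa [r_eq_self hv] at this

theorem RowFinite.finite_degree (hΛ : Λ.RowFinite) (hfin : Λ.vertices.Finite) (n : KDegree k) :
    {μ | Λ.d μ = n}.Finite :=
  (hfin.biUnion fun v hv => hΛ v hv n).subset fun μ hμ =>
    Set.mem_biUnion (Λ.r_mem_vertices μ) ⟨rfl, hμ⟩

end KGraph

/-! ### Cuntz-Krieger families -/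

namespace IsCuntzKriegerFamily

variable {k : ℕ∞} {Λ : KGraph.{u} k} {B : Type*} [NonUnitalCStarAlgebra B] {S : Λ.Path → B}

theorem r_mul (h : IsCuntzKriegerFamily Λ S) (μ : Λ.Path) : S (Λ.r μ) * S μ = S μ := by
  rw [← h.mul _ _ (Λ.s_r μ), Λ.id_comp]

theorem mul_s (h : IsCuntzKriegerFamily Λ S) (μ : Λ.Path) : S μ * S (Λ.s μ) = S μ := by
  rw [← h.mul _ _ (Λ.r_s μ).symm, Λ.comp_id]

theorem star_vertex (h : IsCuntzKriegerFamily Λ S) {v : Λ.Path} (hv : v ∈ Λ.vertices) :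
    star (S v) = S v := (h.projection v hv).isSelfAdjoint.star_eq

theorem s_mul_star (h : IsCuntzKriegerFamily Λ S) (μ : Λ.Path) :
    S (Λ.s μ) * star (S μ) = star (S μ) := by
  conv_rhs => rw [← h.mul_s μ, star_mul, h.star_vertex (Λ.s_mem_vertices μ)]

theorem star_mul_r (h : IsCuntzKriegerFamily Λ S) (μ : Λ.Path) :
    star (S μ) * S (Λ.r μ) = star (S μ) := by
  conv_rhs => rw [← h.r_mul μ, star_mul, h.star_vertex (Λ.r_mem_vertices μ)]

theorem vertex_eq_sum (h : IsCuntzKriegerFamily Λ S) (hΛ : Λ.RowFinite) {v : Λ.Path}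
    (hv : v ∈ Λ.vertices) (n : KDegree k) :
    S v = ∑ μ ∈ (hΛ v hv n).toFinset, S μ * star (S μ) := by
  rw [h.cuntzKrieger v hv n, finsum_mem_eq_finite_toFinset_sum _ (hΛ v hv n)]

theorem mul_eq_zero (h : IsCuntzKriegerFamily Λ S) {μ ν : Λ.Path} (hμν : Λ.s μ ≠ Λ.r ν) :
    S μ * S ν = 0 := by
  rw [← h.mul_s μ, ← h.r_mul ν, mul_assoc, ← mul_assoc (S (Λ.s μ)),
    h.orthogonal _ (Λ.s_mem_vertices μ) _ (Λ.r_mem_vertices ν) hμν, zero_mul, mul_zero]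

theorem isStarProjection_mul_star (h : IsCuntzKriegerFamily Λ S) (μ : Λ.Path) :
    IsStarProjection (S μ * star (S μ)) :=
  ⟨by rw [IsIdempotentElem, ← mul_assoc, h.partialIsometry], IsSelfAdjoint.mul_star_self _⟩

theorem star_mul_eq_zero (h : IsCuntzKriegerFamily Λ S) (hΛ : Λ.RowFinite) {μ ν : Λ.Path}
    (hd : Λ.d μ = Λ.d ν) (hμν : μ ≠ ν) : star (S μ) * S ν = 0 := by
  classical
  by_cases hr : Λ.r μ = Λ.r ν
  · have hrν := Λ.r_mem_vertices ν
    have h1 : S μ * star (S μ) * (S ν * star (S ν)) = 0 := by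
      refine IsStarProjection.mul_eq_zero_of_sum_mul (p := fun μ => S μ * star (S μ))
        (t := (hΛ _ hrν (Λ.d ν)).toFinset)
        (fun α _ => h.isStarProjection_mul_star α) (fun α hα => ?_)
        (by simp [KGraph.pathsTo]) (by simp [KGraph.pathsTo, hr, hd]) hμν
      have hα' : Λ.r α = Λ.r ν := by
        rw [Set.Finite.mem_toFinset] at hα
        exact hα.1
      rw [← h.vertex_eq_sum hΛ hrν, ← hα', ← mul_assoc, h.r_mul]
    have h2 : star (S μ) * S ν = star (S μ) * (S μ * star (S μ) * (S ν * star (S ν))) * S ν := by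
      conv_lhs => rw [← h.partialIsometry μ, ← h.partialIsometry ν]
      simp only [star_mul, star_star, mul_assoc]
    rw [h2, h1, mul_zero, zero_mul]
  · rw [← h.star_mul_r, ← h.r_mul ν, mul_assoc, ← mul_assoc (S (Λ.r μ)),
      h.orthogonal _ (Λ.r_mem_vertices μ) _ (Λ.r_mem_vertices ν) hr, zero_mul, mul_zero]

/-- `S_μ S_ν⋆` is a sum of terms of the same form with longer paths. -/
theorem mul_star_eq_sum (h : IsCuntzKriegerFamily Λ S) (hΛ : Λ.RowFinite) {μ ν : Λ.Path}
    (hs : Λ.s μ = Λ.s ν) (n : KDegree k) :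
    S μ * star (S ν) = ∑ α ∈ (hΛ _ (Λ.s_mem_vertices μ) n).toFinset,
      S (Λ.comp μ α) * star (S (Λ.comp ν α)) := by
  conv_lhs => rw [← h.mul_s μ, h.vertex_eq_sum hΛ (Λ.s_mem_vertices μ) n, Finset.mul_sum,
    Finset.sum_mul]
  refine Finset.sum_congr rfl fun α hα => ?_
  rw [Set.Finite.mem_toFinset] at hα
  rw [h.mul μ α hα.1.symm, h.mul ν α (hs ▸ hα.1.symm), star_mul]
  simp only [mul_assoc]

variable (S) in
/-- The linear span of the elements `S_μ S_ν⋆` with `s μ = s ν`. -/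
def monomialSpan : Submodule ℂ B :=
  Submodule.span ℂ {x | ∃ μ ν, Λ.s μ = Λ.s ν ∧ x = S μ * star (S ν)}

variable (S) in
/-- The linear span of the elements `S_μ S_ν⋆` with `s μ = s ν` and `d μ = d ν = n`. -/
def levelSpan (n : KDegree k) : Submodule ℂ B :=
  Submodule.span ℂ
    {x | ∃ μ ν, Λ.d μ = n ∧ Λ.d ν = n ∧ Λ.s μ = Λ.s ν ∧ x = S μ * star (S ν)}

theorem levelSpan_le_add (h : IsCuntzKriegerFamily Λ S) (hΛ : Λ.RowFinite) (n m : KDegree k) :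
    levelSpan S n ≤ levelSpan S (n + m) := by
  refine Submodule.span_le.mpr ?_
  rintro _ ⟨μ, ν, hμ, hν, hs, rfl⟩
  rw [SetLike.mem_coe, h.mul_star_eq_sum hΛ hs m]
  refine Submodule.sum_mem _ fun α hα => Submodule.subset_span ?_
  rw [Set.Finite.mem_toFinset] at hα
  have h1 := hα.1.symm
  have h2 := hs ▸ h1
  exact ⟨_, _, by rw [Λ.d_comp _ _ h1, hμ, hα.2], by rw [Λ.d_comp _ _ h2, hν, hα.2],
    by rw [Λ.s_comp _ _ h1, Λ.s_comp _ _ h2], rfl⟩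

/-- `S_α⋆ S_μ S_ν⋆` is a combination of monomials: expand `S_μ S_ν⋆` so far that every path which
replaces `μ` has an initial segment of degree `d α`. -/
theorem star_mul_mem_monomialSpan (h : IsCuntzKriegerFamily Λ S) (hΛ : Λ.RowFinite) (α : Λ.Path)
    {x : B} (hx : x ∈ monomialSpan S) : star (S α) * x ∈ monomialSpan S := by
  induction hx using Submodule.span_induction with
  | zero => rw [mul_zero]; exact Submodule.zero_mem _
  | add x y _ _ hx hy => rw [mul_add]; exact Submodule.add_mem _ hx hy
  | smul c x _ hx => rw [mul_smul_comm]; exact Submodule.smul_mem _ c hx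
  | mem x hx =>
    obtain ⟨μ, ν, hs, rfl⟩ := hx
    rw [h.mul_star_eq_sum hΛ hs (Λ.d α), Finset.mul_sum]
    refine Submodule.sum_mem _ fun β hβ => ?_
    rw [Set.Finite.mem_toFinset] at hβ
    have h1 := hβ.1.symm
    have h2 := hs ▸ h1
    have hd : Λ.d (Λ.comp μ β) = Λ.d α + Λ.d μ := by rw [Λ.d_comp _ _ h1, hβ.2, add_comm]
    obtain ⟨γ, δ, hγ, -, hγδ, he⟩ := KGraph.exists_comp_eq hd
    rw [← he, h.mul γ δ hγδ, ← mul_assoc, ← mul_assoc]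
    by_cases hαγ : α = γ
    · subst hαγ
      rw [h.star_mul_self, hγδ, h.r_mul]
      refine Submodule.subset_span ⟨δ, _, ?_, rfl⟩
      rw [Λ.s_comp _ _ h2, ← Λ.s_comp _ _ h1, ← he, Λ.s_comp _ _ hγδ]
    · rw [h.star_mul_eq_zero hΛ hγ.symm hαγ, zero_mul, zero_mul]
      exact Submodule.zero_mem _

theorem mul_mem_monomialSpan (h : IsCuntzKriegerFamily Λ S) (α : Λ.Path)
    {x : B} (hx : x ∈ monomialSpan S) : S α * x ∈ monomialSpan S := by
  induction hx using Submodule.span_induction with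
  | zero => rw [mul_zero]; exact Submodule.zero_mem _
  | add x y _ _ hx hy => rw [mul_add]; exact Submodule.add_mem _ hx hy
  | smul c x _ hx => rw [mul_smul_comm]; exact Submodule.smul_mem _ c hx
  | mem x hx =>
    obtain ⟨μ, ν, hs, rfl⟩ := hx
    rw [← mul_assoc]
    by_cases hαμ : Λ.s α = Λ.r μ
    · rw [← h.mul α μ hαμ]
      exact Submodule.subset_span ⟨_, _, by rw [Λ.s_comp _ _ hαμ, hs], rfl⟩
    · rw [h.mul_eq_zero hαμ, zero_mul]
      exact Submodule.zero_mem _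

theorem star_mem_monomialSpan {x : B} (hx : x ∈ monomialSpan S) :
    star x ∈ monomialSpan S := by
  induction hx using Submodule.span_induction with
  | zero => rw [star_zero]; exact Submodule.zero_mem _
  | add x y _ _ hx hy => rw [star_add]; exact Submodule.add_mem _ hx hy
  | smul c x _ hx => rw [star_smul]; exact Submodule.smul_mem _ _ hx
  | mem x hx =>
    obtain ⟨μ, ν, hs, rfl⟩ := hx
    rw [star_mul, star_star]
    exact Submodule.subset_span ⟨ν, μ, hs.symm, rfl⟩

/-- The monomials `S_μ S_ν⋆` span the `*`-algebra generated by the family. -/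
theorem adjoin_le_monomialSpan (h : IsCuntzKriegerFamily Λ S) (hΛ : Λ.RowFinite) {x : B}
    (hx : x ∈ NonUnitalStarAlgebra.adjoin ℂ (Set.range S)) : x ∈ monomialSpan S := by
  have key : x ∈ monomialSpan S ∧ (∀ y ∈ monomialSpan S, x * y ∈ monomialSpan S) ∧
      ∀ y ∈ monomialSpan S, star x * y ∈ monomialSpan S := by
    induction hx using NonUnitalStarAlgebra.adjoin_induction with
    | mem x hx =>
      obtain ⟨α, rfl⟩ := hx
      refine ⟨?_, fun y => h.mul_mem_monomialSpan α, fun y => h.star_mul_mem_monomialSpan hΛ α⟩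
      refine Submodule.subset_span ⟨α, Λ.s α, (Λ.s_s α).symm, ?_⟩
      rw [h.star_vertex (Λ.s_mem_vertices α), h.mul_s]
    | zero =>
      simp only [star_zero, zero_mul]
      exact ⟨Submodule.zero_mem _, fun _ _ => Submodule.zero_mem _, fun _ _ => Submodule.zero_mem _⟩
    | add x y _ _ hx hy =>
      simp only [star_add, add_mul]
      exact ⟨Submodule.add_mem _ hx.1 hy.1,
        fun z hz => Submodule.add_mem _ (hx.2.1 z hz) (hy.2.1 z hz),
        fun z hz => Submodule.add_mem _ (hx.2.2 z hz) (hy.2.2 z hz)⟩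
    | mul x y _ _ hx hy =>
      simp only [star_mul, mul_assoc]
      exact ⟨hx.2.1 y hy.1, fun z hz => hx.2.1 _ (hy.2.1 z hz),
        fun z hz => hy.2.2 _ (hx.2.2 z hz)⟩
    | smul c x _ hx =>
      simp only [star_smul, smul_mul_assoc]
      exact ⟨Submodule.smul_mem _ _ hx.1, fun z hz => Submodule.smul_mem _ _ (hx.2.1 z hz),
        fun z hz => Submodule.smul_mem _ _ (hx.2.2 z hz)⟩
    | star x _ hx =>
      rw [star_star]
      exact ⟨star_mem_monomialSpan hx.1, hx.2.2, hx.2.1⟩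
  exact key.1

/-! ### The matrix algebras of a Cuntz-Krieger family -/

theorem mul_mem_levelSpan (h : IsCuntzKriegerFamily Λ S) (hΛ : Λ.RowFinite) {n : KDegree k}
    {x y : B} (hx : x ∈ levelSpan S n) (hy : y ∈ levelSpan S n) : x * y ∈ levelSpan S n := by
  induction hx using Submodule.span_induction with
  | zero => rw [zero_mul]; exact Submodule.zero_mem _
  | add x z _ _ hx hz => rw [add_mul]; exact Submodule.add_mem _ hx hz
  | smul c x _ hx => rw [smul_mul_assoc]; exact Submodule.smul_mem _ c hx
  | mem x hx =>
    obtain ⟨μ, ν, hμ, hν, hs, rfl⟩ := hx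
    induction hy using Submodule.span_induction with
    | zero => rw [mul_zero]; exact Submodule.zero_mem _
    | add x y _ _ hx hy => rw [mul_add]; exact Submodule.add_mem _ hx hy
    | smul c x _ hx => rw [mul_smul_comm]; exact Submodule.smul_mem _ c hx
    | mem y hy =>
      obtain ⟨α, β, hα, hβ, hs', rfl⟩ := hy
      rw [mul_assoc, ← mul_assoc (star (S ν))]
      by_cases hνα : ν = α
      · subst hνα
        rw [h.star_mul_self, hs', h.s_mul_star]
        exact Submodule.subset_span ⟨μ, β, hμ, hβ, hs.trans hs', rfl⟩
      · rw [h.star_mul_eq_zero hΛ (hν.trans hα.symm) hνα, zero_mul, mul_zero]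
        exact Submodule.zero_mem _

theorem star_mem_levelSpan {n : KDegree k} {x : B} (hx : x ∈ levelSpan S n) :
    star x ∈ levelSpan S n := by
  induction hx using Submodule.span_induction with
  | zero => rw [star_zero]; exact Submodule.zero_mem _
  | add x y _ _ hx hy => rw [star_add]; exact Submodule.add_mem _ hx hy
  | smul c x _ hx => rw [star_smul]; exact Submodule.smul_mem _ _ hx
  | mem x hx =>
    obtain ⟨μ, ν, hμ, hν, hs, rfl⟩ := hx
    rw [star_mul, star_star]
    exact Submodule.subset_span ⟨ν, μ, hν, hμ, hs.symm, rfl⟩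

/-- `levelSpan S n` as a `*`-algebra. It is a quotient of the direct sum over the vertices `v` of
the matrix algebras with index sets `{μ | d μ = n, s μ = v}`. -/
def levelAlgebra (h : IsCuntzKriegerFamily Λ S) (hΛ : Λ.RowFinite) (n : KDegree k) :
    NonUnitalStarSubalgebra ℂ B where
  toSubmodule := levelSpan S n
  mul_mem' := h.mul_mem_levelSpan hΛ
  star_mem' := star_mem_levelSpan

theorem finiteDimensional_levelSpan (hΛ : Λ.RowFinite) (hfin : Λ.vertices.Finite)
    (n : KDegree k) : FiniteDimensional ℂ (levelSpan S n) := by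
  refine FiniteDimensional.span_of_finite ℂ ?_
  have hn := hΛ.finite_degree hfin n
  refine ((hn.prod hn).image fun p => S p.1 * star (S p.2)).subset ?_
  rintro _ ⟨μ, ν, hμ, hν, -, rfl⟩
  exact ⟨(μ, ν), ⟨hμ, hν⟩, rfl⟩

theorem isClosed_levelAlgebra (h : IsCuntzKriegerFamily Λ S) (hΛ : Λ.RowFinite)
    (hfin : Λ.vertices.Finite) (n : KDegree k) : IsClosed (h.levelAlgebra hΛ n : Set B) := by
  have := finiteDimensional_levelSpan (S := S) hΛ hfin n
  exact Submodule.closed_of_finiteDimensional (levelSpan S n)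

/-- The matrix coefficients of an element of the `n`-th matrix algebra. -/
theorem exists_star_mul_mul_eq_smul (h : IsCuntzKriegerFamily Λ S) (hΛ : Λ.RowFinite)
    {n : KDegree k} {x : B} (hx : x ∈ levelSpan S n) {μ ν : Λ.Path} (hμ : Λ.d μ = n)
    (hν : Λ.d ν = n) : ∃ c : ℂ, star (S μ) * x * S ν = c • S (Λ.s μ) := by
  induction hx using Submodule.span_induction with
  | zero => exact ⟨0, by simp⟩
  | add x y _ _ hx hy =>
    obtain ⟨c, hc⟩ := hx
    obtain ⟨e, he⟩ := hy
    exact ⟨c + e, by rw [mul_add, add_mul, hc, he, add_smul]⟩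
  | smul c x _ hx =>
    obtain ⟨e, he⟩ := hx
    exact ⟨c * e, by rw [mul_smul_comm, smul_mul_assoc, he, smul_smul]⟩
  | mem x hx =>
    obtain ⟨α, β, hα, hβ, hs, rfl⟩ := hx
    have he : star (S μ) * (S α * star (S β)) * S ν = star (S μ) * S α * (star (S β) * S ν) := by
      simp only [mul_assoc]
    rw [he]
    by_cases h1 : μ = α
    · by_cases h2 : β = ν
      · subst h1 h2
        refine ⟨1, ?_⟩
        rw [h.star_mul_self, h.star_mul_self, hs, one_smul,
          (h.projection _ (Λ.s_mem_vertices _)).isIdempotentElem.eq]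
      · exact ⟨0, by rw [h.star_mul_eq_zero hΛ (hβ.trans hν.symm) h2, mul_zero, zero_smul]⟩
    · exact ⟨0, by rw [h.star_mul_eq_zero hΛ (hμ.trans hα.symm) h1, zero_mul, zero_smul]⟩

/-- An element of the `n`-th matrix algebra with vanishing matrix coefficients vanishes. -/
theorem eq_zero_of_star_mul_mul_eq_zero (h : IsCuntzKriegerFamily Λ S) (hΛ : Λ.RowFinite)
    (hfin : Λ.vertices.Finite) {n : KDegree k} {x : B} (hx : x ∈ levelSpan S n)
    (h0 : ∀ μ ν, Λ.d μ = n → Λ.d ν = n → star (S μ) * x * S ν = 0) : x = 0 := by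
  classical
  set t := (hΛ.finite_degree hfin n).toFinset
  have ht : ∀ {μ}, μ ∈ t ↔ Λ.d μ = n := fun {μ} => Set.Finite.mem_toFinset _
  set p := ∑ μ ∈ t, S μ * star (S μ) with hp
  -- `p` is the unit of the matrix algebra.
  have hpS : ∀ μ, Λ.d μ = n → p * S μ = S μ := by
    intro μ hμ
    rw [hp, Finset.sum_mul, Finset.sum_eq_single_of_mem μ (ht.mpr hμ), h.partialIsometry]
    intro ν hν hne
    rw [mul_assoc, h.star_mul_eq_zero hΛ ((ht.mp hν).trans hμ.symm) hne, mul_zero]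
  have hps : star p = p := by
    simp [hp, star_sum]
  have hSp : ∀ μ, Λ.d μ = n → star (S μ) * p = star (S μ) := by
    intro μ hμ
    conv_rhs => rw [← hpS μ hμ, star_mul, hps]
  have hpx : p * x * p = x := by
    clear h0
    induction hx using Submodule.span_induction with
    | zero => simp
    | add x y _ _ hx hy => rw [mul_add, add_mul, hx, hy]
    | smul c x _ hx => rw [mul_smul_comm, smul_mul_assoc, hx]
    | mem x hx =>
      obtain ⟨α, β, hα, hβ, hs, rfl⟩ := hx
      rw [← mul_assoc, hpS α hα, mul_assoc, hSp β hβ]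
  rw [← hpx, hp, Finset.sum_mul, Finset.sum_mul]
  refine Finset.sum_eq_zero fun μ hμ => ?_
  rw [Finset.mul_sum]
  refine Finset.sum_eq_zero fun ν hν => ?_
  have he : S μ * star (S μ) * x * (S ν * star (S ν)) =
      S μ * (star (S μ) * x * S ν) * star (S ν) := by simp only [mul_assoc]
  rw [he, h0 μ ν (ht.mp hμ) (ht.mp hν), mul_zero, zero_mul]

/-- A `*`-homomorphism that kills no vertex projection is isometric on the matrix algebras. -/
theorem norm_map_eq_of_mem_levelSpan (h : IsCuntzKriegerFamily Λ S) (hΛ : Λ.RowFinite)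
    (hfin : Λ.vertices.Finite) {D : Type*} [NonUnitalCStarAlgebra D] (φ : B →⋆ₙₐ[ℂ] D)
    (hφ : ∀ v ∈ Λ.vertices, φ (S v) ≠ 0) {n : KDegree k} {x : B} (hx : x ∈ levelSpan S n) :
    ‖φ x‖ = ‖x‖ := by
  let _ : NonUnitalCStarAlgebra (h.levelAlgebra hΛ n) :=
    NonUnitalStarSubalgebra.nonUnitalCStarAlgebra _
      (h_closed := h.isClosed_levelAlgebra hΛ hfin n)
  have hinj : Function.Injective (φ.comp (NonUnitalStarSubalgebraClass.subtype
      (h.levelAlgebra hΛ n))) := by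
    rw [injective_iff_map_eq_zero]
    rintro ⟨y, hy⟩ h0
    replace h0 : φ y = 0 := h0
    refine Subtype.ext (h.eq_zero_of_star_mul_mul_eq_zero hΛ hfin hy fun μ ν hμ hν => ?_)
    obtain ⟨c, hc⟩ := h.exists_star_mul_mul_eq_smul hΛ hy hμ hν
    have h1 : c • φ (S (Λ.s μ)) = 0 := by
      rw [← map_smul, ← hc, map_mul, map_mul, h0, mul_zero, zero_mul]
    rw [hc, (smul_eq_zero.mp h1).resolve_right (hφ _ (Λ.s_mem_vertices μ)), zero_smul]
  exact NonUnitalStarAlgHom.norm_map _ hinj (⟨x, hx⟩ : h.levelAlgebra hΛ n)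

end IsCuntzKriegerFamily
/-! ### Homomorphisms between algebras generated by product families -/

namespace ProductFamily

variable {I X J Y : Type*} {A : I → Type*} [∀ i, NonUnitalCStarAlgebra (A i)]
  {C : J → Type*} [∀ j, NonUnitalCStarAlgebra (C j)]
  {f : ∀ i, X → A i} {hf : ∀ i x, ‖f i x‖ ≤ 1} {g : ∀ j, Y → C j} {hg : ∀ j y, ‖g j y‖ ≤ 1}

/-- Homomorphisms into the coordinates of a second product family assemble to a homomorphism
between the generated algebras, provided that it maps the generators into the second algebra. -/
theorem exists_hom (e : ∀ j, algebra f hf →⋆ₙₐ[ℂ] C j) (y : X → algebra g hg)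
    (h : ∀ j x, e j (gen f hf x) = eval g hg j (y x)) :
    ∃ L : algebra f hf →⋆ₙₐ[ℂ] algebra g hg, ∀ x, L (gen f hf x) = y x := by
  let E : algebra f hf →⋆ₙₐ[ℂ] lp C ∞ :=
    { toFun := fun b => ⟨fun j => e j b, memℓp_infty ⟨‖b‖, by
        rintro _ ⟨j, rfl⟩
        exact NonUnitalStarAlgHom.norm_apply_le (e j) b⟩⟩
      map_smul' := fun c b => lp.ext (funext fun j => map_smul (e j) c b)
      map_zero' := lp.ext (funext fun j => map_zero (e j))
      map_add' := fun a b => lp.ext (funext fun j => map_add (e j) a b)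
      map_mul' := fun a b => lp.ext (funext fun j => map_mul (e j) a b)
      map_star' := fun a => lp.ext (funext fun j => map_star (e j) a) }
  have hE : ∀ x, E (gen f hf x) = y x := fun x => lp.ext (funext fun j => h j x)
  have hcont : Continuous E := (NonUnitalStarAlgHom.instContinuousLinearMapClassComplex
    (F := algebra f hf →⋆ₙₐ[ℂ] lp C ∞)).map_continuous E
  have hcl : IsClosed {b | E b ∈ algebra g hg} :=
    (NonUnitalStarSubalgebra.isClosed_topologicalClosure _).preimage hcont
  have key : ∀ (b : lp A ∞) (hb : b ∈ NonUnitalStarAlgebra.adjoin ℂ (Set.range (family f hf))),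
      E ⟨b, NonUnitalStarSubalgebra.le_topologicalClosure _ hb⟩ ∈ algebra g hg := by
    intro b hb
    induction hb using NonUnitalStarAlgebra.adjoin_induction with
    | mem z hz =>
      obtain ⟨x, rfl⟩ := hz
      have := hE x
      rw [gen] at this
      rw [this]
      exact (y x).2
    | zero => exact (map_zero E).symm ▸ zero_mem _
    | add b c hb hc h1 h2 =>
      have := add_mem h1 h2
      rw [← map_add] at this
      exact this
    | mul b c hb hc h1 h2 =>
      have := mul_mem h1 h2
      rw [← map_mul] at this
      exact this
    | smul c b hb h1 =>
      have := SMulMemClass.smul_mem c h1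
      rw [← map_smul] at this
      exact this
    | star b hb h1 =>
      have := star_mem h1
      rw [← map_star] at this
      exact this
  have hmem : ∀ b, E b ∈ algebra g hg := by
    rintro ⟨b, hb⟩
    refine hcl.closure_subset ?_
    rw [closure_subtype]
    refine closure_mono ?_ hb
    intro c hc
    exact ⟨⟨c, NonUnitalStarSubalgebra.le_topologicalClosure _ hc⟩, key c hc, rfl⟩
  exact ⟨NonUnitalStarAlgHom.codRestrict E (algebra g hg) hmem, fun x => Subtype.ext (hE x)⟩

/-- The generators generate a dense `*`-subalgebra. -/
theorem mem_closure_adjoin_gen (a : algebra f hf) :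
    a ∈ closure (NonUnitalStarAlgebra.adjoin ℂ (Set.range (gen f hf)) : Set (algebra f hf)) := by
  obtain ⟨a, ha⟩ := a
  rw [closure_subtype]
  refine closure_mono ?_ ha
  intro b hb
  refine ⟨⟨b, NonUnitalStarSubalgebra.le_topologicalClosure _ hb⟩, ?_, rfl⟩
  induction hb using NonUnitalStarAlgebra.adjoin_induction with
  | mem z hz =>
    obtain ⟨x, rfl⟩ := hz
    exact NonUnitalStarAlgebra.subset_adjoin ℂ _ ⟨x, rfl⟩
  | zero => exact zero_mem (NonUnitalStarAlgebra.adjoin ℂ (Set.range (gen f hf)))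
  | add b c hb hc h1 h2 => exact add_mem h1 h2
  | mul b c hb hc h1 h2 => exact mul_mem h1 h2
  | smul c b hb h1 => exact SMulMemClass.smul_mem c h1
  | star b hb h1 => exact star_mem h1

end ProductFamily

/-! ### Characters of the torus and gauge twists -/

/-- The torus `𝕋^k`, the compact dual group of `ℤ^k`. -/
abbrev Torus (k : ℕ∞) : Type := {i : ℕ // (i : ℕ∞) < k} → Circle

namespace Torus

variable {k : ℕ∞}

/-- The monomial `z^n`. -/
def monomial (z : Torus k) (n : KDegree k) : Circle := n.prod fun i e => z i ^ e

theorem monomial_zero (z : Torus k) : monomial z 0 = 1 := Finsupp.prod_zero_index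

theorem monomial_add (z : Torus k) (n m : KDegree k) :
    monomial z (n + m) = monomial z n * monomial z m :=
  Finsupp.prod_add_index' (fun _ => pow_zero _) fun _ => pow_add _

theorem one_monomial (n : KDegree k) : monomial 1 n = 1 := by
  simp [monomial, Finsupp.prod]

theorem mul_monomial (z w : Torus k) (n : KDegree k) :
    monomial (z * w) n = monomial z n * monomial w n := by
  simp [monomial, mul_pow, Finsupp.prod_mul]

theorem continuous_monomial (n : KDegree k) : Continuous fun z : Torus k => monomial z n :=
  continuous_finsetProd _ fun i _ => (continuous_apply i).pow _

theorem conj_mul_monomial (z : Torus k) (n : KDegree k) :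
    (starRingEnd ℂ) (monomial z n : ℂ) * (monomial z n : ℂ) = 1 := by
  rw [← Circle.coe_inv_eq_conj, ← Circle.coe_mul, inv_mul_cancel, Circle.coe_one]

/-- The monomials separate degrees. -/
theorem exists_monomial_ne {n m : KDegree k} (h : n ≠ m) :
    ∃ z : Torus k, monomial z n ≠ monomial z m := by
  classical
  obtain ⟨i, hi⟩ := Finsupp.ne_iff.mp h
  have hne : ((n i : ℤ) : ℝ) - (m i : ℤ) ≠ 0 := by
    rw [sub_ne_zero]
    exact_mod_cast hi
  -- With `u = exp (iπ / (n i - m i))`, the quotient of the two monomials is `exp (iπ) = -1`.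
  set u : Circle := Circle.exp (Real.pi / (((n i : ℤ) : ℝ) - (m i : ℤ)))
  have hmon : ∀ l : KDegree k, monomial (Pi.mulSingle i u) l = u ^ l i := by
    intro l
    rw [monomial, Finsupp.prod, Finset.prod_eq_single i]
    · rw [Pi.mulSingle_eq_same]
    · intro j _ hj
      rw [Pi.mulSingle_eq_of_ne hj, one_pow]
    · intro hl
      rw [Finsupp.notMem_support_iff.mp hl, pow_zero]
  refine ⟨Pi.mulSingle i u, fun he => ?_⟩
  rw [hmon, hmon] at he
  have h1 : u ^ ((n i : ℤ) - (m i : ℤ)) = 1 := by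
    rw [zpow_sub, zpow_natCast, zpow_natCast, he, mul_inv_cancel]
  have h2 : u ^ ((n i : ℤ) - (m i : ℤ)) = Circle.exp Real.pi := by
    rw [← Circle.exp_zsmul]
    congr 1
    rw [zsmul_eq_mul]
    push_cast at hne ⊢
    field_simp
  rw [h2] at h1
  have h3 := congrArg (fun c : Circle => (c : ℂ)) h1
  simp only [Circle.coe_exp, Complex.exp_pi_mul_I, Circle.coe_one] at h3
  norm_num at h3

end Torus

/-- Multiplying the partial isometries by the values of a character at their degrees gives a
Cuntz-Krieger family again. -/
theorem IsCuntzKriegerFamily.twist {k : ℕ∞} {Λ : KGraph.{u} k} {B : Type*}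
    [NonUnitalCStarAlgebra B] {S : Λ.Path → B} (h : IsCuntzKriegerFamily Λ S) (z : Torus k) :
    IsCuntzKriegerFamily Λ fun μ => (Torus.monomial z (Λ.d μ) : ℂ) • S μ := by
  have hv : ∀ v ∈ Λ.vertices, (Torus.monomial z (Λ.d v) : ℂ) • S v = S v := by
    intro v hv
    rw [show Λ.d v = 0 from hv, Torus.monomial_zero, Circle.coe_one, one_smul]
  have hstar : ∀ μ, (Torus.monomial z (Λ.d μ) : ℂ) • S μ *
      star ((Torus.monomial z (Λ.d μ) : ℂ) • S μ) = S μ * star (S μ) := by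
    intro μ
    rw [star_smul, smul_mul_smul_comm, mul_comm, Complex.star_def, Torus.conj_mul_monomial,
      one_smul]
  refine ⟨fun μ => ?_, fun v hv' => ?_, fun v hv' w hw' hne => ?_, fun μ ν hs => ?_, fun μ => ?_,
    fun v hv' n => ?_⟩
  · rw [hstar, mul_smul_comm, h.partialIsometry]
  · rw [hv v hv']
    exact h.projection v hv'
  · rw [hv v hv', hv w hw', h.orthogonal v hv' w hw' hne]
  · rw [Λ.d_comp _ _ hs, Torus.monomial_add, Circle.coe_mul, h.mul _ _ hs, smul_mul_smul_comm]
  · rw [star_smul, smul_mul_smul_comm, Complex.star_def, Torus.conj_mul_monomial, one_smul,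
      h.star_mul_self, hv _ (Λ.s_mem_vertices μ)]
  · simp only [hstar]
    rw [hv v hv', h.cuntzKrieger v hv' n]

/-! ### The gauge-invariant uniqueness theorem -/

namespace IsCuntzKriegerFamily

open MeasureTheory Torus

variable {k : ℕ∞} {Λ : KGraph.{u} k} {A : Type*} [NonUnitalCStarAlgebra A] {S : Λ.Path → A}

theorem gauge_mul_star {γ : A →⋆ₙₐ[ℂ] A} {z : Torus k}
    (hγ : ∀ μ, γ (S μ) = (monomial z (Λ.d μ) : ℂ) • S μ) (μ ν : Λ.Path) :
    γ (S μ * star (S ν)) =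
      ((monomial z (Λ.d μ) / monomial z (Λ.d ν) : Circle) : ℂ) • (S μ * star (S ν)) := by
  rw [map_mul, map_star, hγ, hγ, star_smul, smul_mul_smul_comm, div_eq_mul_inv, Circle.coe_mul,
    Circle.coe_inv_eq_conj, Complex.star_def]

/-- A gauge action is strongly continuous. -/
theorem continuous_gauge (h : IsCuntzKriegerFamily Λ S) (hΛ : Λ.RowFinite)
    (hgen : ∀ a : A, a ∈ closure (NonUnitalStarAlgebra.adjoin ℂ (Set.range S) : Set A))
    {γ : Torus k → A →⋆ₙₐ[ℂ] A} (hγ : ∀ z μ, γ z (S μ) = (monomial z (Λ.d μ) : ℂ) • S μ)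
    (a : A) : Continuous fun z => γ z a := by
  have hmon : ∀ x ∈ monomialSpan S, Continuous fun z => γ z x := by
    intro x hx
    induction hx using Submodule.span_induction with
    | zero => simpa only [map_zero] using continuous_const
    | add x y _ _ hx hy => simp only [map_add]; exact hx.add hy
    | smul c x _ hx => simp only [map_smul]; exact hx.const_smul c
    | mem x hx =>
      obtain ⟨μ, ν, -, rfl⟩ := hx
      simp only [fun z => gauge_mul_star (hγ z) μ ν]
      refine Continuous.smul ?_ continuous_const
      exact continuous_subtype_val.comp ((continuous_monomial _).div' (continuous_monomial _))
  refine continuous_of_uniform_approx_of_continuous fun u hu => ?_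
  obtain ⟨ε, hε, hεu⟩ := Metric.mem_uniformity_dist.mp hu
  obtain ⟨b, hb, hab⟩ := Metric.mem_closure_iff.mp (hgen a) ε hε
  refine ⟨fun z => γ z b, hmon b (h.adjoin_le_monomialSpan hΛ hb), fun z => hεu ?_⟩
  rw [dist_eq_norm, ← map_sub]
  rw [dist_eq_norm] at hab
  exact (NonUnitalStarAlgHom.norm_apply_le (γ z) _).trans_lt hab

/-- **Gauge-invariant uniqueness.** On a C*-algebra generated by a Cuntz-Krieger family and
carrying a gauge action, a `*`-homomorphism with gauge-invariant kernel that kills no vertex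
projection is injective. -/
theorem injective_of_gauge_invariant (h : IsCuntzKriegerFamily Λ S) (hΛ : Λ.RowFinite)
    (hfin : Λ.vertices.Finite)
    (hgen : ∀ a : A, a ∈ closure (NonUnitalStarAlgebra.adjoin ℂ (Set.range S) : Set A))
    {γ : Torus k → A →⋆ₙₐ[ℂ] A} (hγ : ∀ z μ, γ z (S μ) = (monomial z (Λ.d μ) : ℂ) • S μ)
    {D : Type*} [NonUnitalCStarAlgebra D] (φ : A →⋆ₙₐ[ℂ] D)
    (hφ : ∀ v ∈ Λ.vertices, φ (S v) ≠ 0) (hker : ∀ z a, φ a = 0 → φ (γ z a) = 0) :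
    Function.Injective φ := by
  let _ : MeasurableSpace (Torus k) := borel _
  have : BorelSpace (Torus k) := ⟨rfl⟩
  let m : Measure (Torus k) := Measure.haar
  have hcont := h.continuous_gauge hΛ hgen hγ
  have hint : ∀ a, Integrable (fun z => γ z a) m := fun a =>
    (hcont a).integrable_of_hasCompactSupport (HasCompactSupport.of_compactSpace _)
  -- Up to a scalar, the conditional expectation onto the fixed points of the gauge action.
  set E : A → A := fun a => ∫ z, γ z a ∂m with hE
  have hmono : ∀ μ ν, Λ.d μ ≠ Λ.d ν → E (S μ * star (S ν)) = 0 := by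
    intro μ ν hd
    simp only [hE, fun z => gauge_mul_star (hγ z) μ ν]
    rw [integral_smul_const]
    -- The integral of a nontrivial character vanishes by translation invariance.
    obtain ⟨w, hw⟩ := exists_monomial_ne hd
    have h1 := integral_mul_left_eq_self (μ := m) (fun z : Torus k =>
      ((monomial z (Λ.d μ) / monomial z (Λ.d ν) : Circle) : ℂ)) w
    simp only [mul_monomial, mul_div_mul_comm, Circle.coe_mul, Circle.coe_div] at h1
    rw [integral_const_mul] at h1
    by_cases h0 : ∫ z : Torus k, (monomial z (Λ.d μ) : ℂ) / monomial z (Λ.d ν) ∂m = 0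
    · simp only [Circle.coe_div, h0, zero_smul]
    · refine absurd ?_ hw
      have h2 := mul_right_cancel₀ h0 (h1.trans (one_mul _).symm)
      exact div_eq_one.mp (Circle.ext (by rw [Circle.coe_div, h2, Circle.coe_one]))
  have hlevel : ∀ x ∈ monomialSpan S, ∃ n, E x ∈ levelSpan S n := by
    intro x hx
    induction hx using Submodule.span_induction with
    | zero => exact ⟨0, by simp [hE]⟩
    | add x y _ _ hx hy =>
      obtain ⟨n, hn⟩ := hx
      obtain ⟨l, hl⟩ := hy
      refine ⟨n + l, ?_⟩
      simp only [hE, map_add]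
      rw [integral_add (hint x) (hint y)]
      exact Submodule.add_mem _ (h.levelSpan_le_add hΛ n l hn)
        (add_comm l n ▸ h.levelSpan_le_add hΛ l n hl)
    | smul c x _ hx =>
      obtain ⟨n, hn⟩ := hx
      refine ⟨n, ?_⟩
      simp only [hE, map_smul]
      rw [integral_smul]
      exact Submodule.smul_mem _ c hn
    | mem x hx =>
      obtain ⟨μ, ν, hs, rfl⟩ := hx
      by_cases hd : Λ.d μ = Λ.d ν
      · refine ⟨Λ.d μ, ?_⟩
        simp only [hE, fun z => gauge_mul_star (hγ z) μ ν]
        rw [integral_smul_const]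
        exact Submodule.smul_mem _ _ (Submodule.subset_span ⟨μ, ν, rfl, hd.symm, hs, rfl⟩)
      · exact ⟨0, by rw [hmono μ ν hd]; exact Submodule.zero_mem _⟩
  have hEcont : Continuous E := by
    refine (LipschitzWith.of_dist_le_mul (K := ⟨m.real Set.univ, measureReal_nonneg⟩)
      fun a b => ?_).continuous
    rw [dist_eq_norm, dist_eq_norm, hE]
    simp only
    rw [← integral_sub (hint a) (hint b)]
    refine le_of_le_of_eq ?_ (mul_comm ‖a - b‖ (m.real Set.univ))
    refine norm_integral_le_of_norm_le_const (Filter.Eventually.of_forall fun z => ?_)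
    rw [← map_sub]
    exact NonUnitalStarAlgHom.norm_apply_le (γ z) _
  have hφcont : Continuous φ := (NonUnitalStarAlgHom.instContinuousLinearMapClassComplex
    (F := A →⋆ₙₐ[ℂ] D)).map_continuous φ
  have hnorm : ∀ a, ‖φ (E a)‖ = ‖E a‖ := by
    intro a
    have hcl : IsClosed {a | ‖φ (E a)‖ = ‖E a‖} :=
      isClosed_eq (hφcont.comp hEcont).norm hEcont.norm
    refine hcl.closure_subset_iff.mpr (fun x hx => ?_) (hgen a)
    obtain ⟨n, hn⟩ := hlevel x (h.adjoin_le_monomialSpan hΛ hx)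
    exact h.norm_map_eq_of_mem_levelSpan hΛ hfin φ hφ hn
  rw [injective_iff_map_eq_zero]
  intro a ha
  have h0 : φ (star a * a) = 0 := by rw [map_mul, ha, mul_zero]
  have h1 : φ (E (star a * a)) = 0 := by
    let φ' : A →L[ℂ] D := ⟨φ, hφcont⟩
    have := φ'.integral_comp_comm (hint (star a * a))
    refine this.symm.trans ?_
    exact integral_eq_zero_of_ae (Filter.Eventually.of_forall fun z => hker z _ h0)
  have h2 : E (star a * a) = 0 := by rw [← norm_eq_zero, ← hnorm, h1, norm_zero]
  have h3 := eq_zero_of_integral_star_mul_self_eq_zero (hcont (star a * a))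
    (fun z => ⟨γ z a, by rw [map_mul, map_star]⟩) h2 1
  have hγ1 : ∀ b, γ 1 b = b := by
    intro b
    have hγc : Continuous (γ 1) := (NonUnitalStarAlgHom.instContinuousLinearMapClassComplex
      (F := A →⋆ₙₐ[ℂ] A)).map_continuous (γ 1)
    refine (isClosed_eq hγc continuous_id).closure_subset_iff.mpr (fun x hx => ?_) (hgen b)
    replace hx := h.adjoin_le_monomialSpan hΛ hx
    change γ 1 x = x
    induction hx using Submodule.span_induction with
    | zero => exact map_zero _
    | add x y _ _ hx hy => rw [map_add, hx, hy]
    | smul c x _ hx => rw [map_smul, hx]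
    | mem x hx =>
      obtain ⟨μ, ν, -, rfl⟩ := hx
      rw [gauge_mul_star (hγ 1), one_monomial, one_monomial, div_one, Circle.coe_one, one_smul]
  rw [hγ1] at h3
  exact (CStarRing.star_mul_self_eq_zero_iff a).mp h3

end IsCuntzKriegerFamily
/-! ### Operators induced by partial bijections -/

namespace PEquiv

variable {X : Type*}

open Classical in
theorem dite_choose_eq_some_iff {P : X → Prop} (hP : ∀ y y', P y → P y' → y = y') {y : X} :
    (if h : ∃ y, P y then some h.choose else none) = some y ↔ P y := by
  rw [Option.dite_none_right_eq_some]
  constructor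
  · rintro ⟨h, h'⟩
    exact Option.some.inj h' ▸ h.choose_spec
  · exact fun h => ⟨⟨y, h⟩, congrArg some (hP _ _ (Exists.choose_spec ⟨y, h⟩) h)⟩

open Classical in
/-- The partial bijection whose graph is a given relation. -/
def ofRel (R : X → X → Prop) (hfun : ∀ x y y', R x y → R x y' → y = y')
    (hinj : ∀ x x' y, R x y → R x' y → x = x') : X ≃. X where
  toFun x := if h : ∃ y, R x y then some h.choose else none
  invFun y := if h : ∃ x, R x y then some h.choose else none
  inv x y := (dite_choose_eq_some_iff fun x x' => hinj x x' y).trans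
    (dite_choose_eq_some_iff (hfun x)).symm

theorem mem_ofRel {R : X → X → Prop} {hfun : ∀ x y y', R x y → R x y' → y = y'}
    {hinj : ∀ x x' y, R x y → R x' y → x = x'} {x y : X} :
    y ∈ ofRel R hfun hinj x ↔ R x y :=
  dite_choose_eq_some_iff (hfun x)

/-- The graph of a partial bijection. -/
abbrev Graph (f : X ≃. X) : Type _ := {p : X × X // p.2 ∈ f p.1}

theorem Graph.fst_injective (f : X ≃. X) : Function.Injective fun p : f.Graph => p.1.1 := by
  rintro ⟨⟨x, y⟩, h⟩ ⟨⟨x', y'⟩, h'⟩ (rfl : x = x')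
  obtain rfl := Option.mem_unique h h'
  rfl

theorem Graph.snd_injective (f : X ≃. X) : Function.Injective fun p : f.Graph => p.1.2 := by
  rintro ⟨⟨x, y⟩, h⟩ ⟨⟨x', y'⟩, h'⟩ (rfl : y = y')
  obtain rfl := f.inj h h'
  rfl

/-- The function on the codomain of a partial bijection obtained by moving a function on its
domain, and extending it by zero. -/
def push (f : X ≃. X) (ξ : X → ℂ) (y : X) : ℂ := (f.symm y).elim 0 ξ

theorem push_of_mem {f : X ≃. X} {x y : X} (h : y ∈ f x) (ξ : X → ℂ) : f.push ξ y = ξ x := by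
  rw [push, Option.mem_def.mp (f.mem_iff_mem.mpr h), Option.elim]

theorem push_of_notMem {f : X ≃. X} {y : X} (h : ∀ x, y ∉ f x) (ξ : X → ℂ) :
    f.push ξ y = 0 := by
  rw [push]
  cases hy : f.symm y with
  | none => rfl
  | some x => exact absurd (f.mem_iff_mem.mp (Option.mem_def.mpr hy)) (h x)

theorem mem_range_snd_of_push_ne_zero {f : X ≃. X} {ξ : X → ℂ} {y : X} (h : f.push ξ y ≠ 0) :
    y ∈ Set.range fun p : f.Graph => p.1.2 := by
  by_contra hy
  exact h (push_of_notMem (fun x hx => hy ⟨⟨(x, y), hx⟩, rfl⟩) ξ)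

theorem summable_push (f : X ≃. X) (ξ : lp (fun _ : X => ℂ) 2) :
    Summable fun y => ‖f.push ξ y‖ ^ (2 : ℝ≥0∞).toReal := by
  have h1 : Summable fun x => ‖ξ x‖ ^ (2 : ℝ≥0∞).toReal := (lp.memℓp ξ).summable (by simp)
  rw [← (Graph.snd_injective f).summable_iff]
  · refine (h1.comp_injective (Graph.fst_injective f)).congr fun p => ?_
    simp only [Function.comp, push_of_mem p.2]
  · intro y hy
    rw [not_ne_iff.mp (mt mem_range_snd_of_push_ne_zero hy)]
    simp

/-- The partial isometry on `ℓ²(X)` that moves the basis vectors by a partial bijection of `X`, and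
kills those outside its domain. -/
def toOp (f : X ≃. X) : lp (fun _ : X => ℂ) 2 →L[ℂ] lp (fun _ : X => ℂ) 2 :=
  LinearMap.mkContinuous
    { toFun := fun ξ => ⟨f.push ξ, memℓp_gen (f.summable_push ξ)⟩
      map_add' := fun ξ η => lp.ext (funext fun y => by
        change f.push (⇑ξ + ⇑η) y = f.push ξ y + f.push η y
        simp only [push]
        cases f.symm y
        · exact (add_zero 0).symm
        · rfl)
      map_smul' := fun c ξ => lp.ext (funext fun y => by
        change f.push (c • ⇑ξ) y = c • f.push ξ y
        simp only [push]
        cases f.symm y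
        · exact (smul_zero c).symm
        · rfl) } 1 fun ξ => by
    rw [one_mul]
    refine (Real.rpow_le_rpow_iff (norm_nonneg _) (norm_nonneg _)
      (z := (2 : ℝ≥0∞).toReal) (by simp)).mp ?_
    rw [lp.norm_rpow_eq_tsum (by simp), lp.norm_rpow_eq_tsum (by simp)]
    have h1 : Summable fun x => ‖ξ x‖ ^ (2 : ℝ≥0∞).toReal := (lp.memℓp ξ).summable (by simp)
    change ∑' y, ‖f.push ξ y‖ ^ (2 : ℝ≥0∞).toReal ≤ _
    rw [← (Graph.snd_injective f).tsum_eq]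
    · simp only [fun p : f.Graph => push_of_mem p.2 ξ]
      exact tsum_comp_le_tsum_of_inj h1 (fun x => by positivity) (Graph.fst_injective f)
    · intro y hy
      refine mem_range_snd_of_push_ne_zero (ξ := ξ) fun h0 => hy ?_
      simp [h0]

theorem toOp_apply (f : X ≃. X) (ξ : lp (fun _ : X => ℂ) 2) (y : X) :
    f.toOp ξ y = f.push ξ y := rfl

theorem toOp_trans (f g : X ≃. X) : (f.trans g).toOp = g.toOp * f.toOp := by
  ext ξ z
  rw [mul_apply_eq_comp, toOp_apply, toOp_apply]
  simp only [push, symm_trans_rev]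
  change ((g.symm z).bind f.symm).elim 0 ξ = (g.symm z).elim 0 (f.toOp ξ)
  cases g.symm z <;> rfl

theorem toOp_refl : (PEquiv.refl X).toOp = 1 := by
  ext ξ z
  rfl

theorem star_toOp (f : X ≃. X) : star f.toOp = f.symm.toOp := by
  rw [ContinuousLinearMap.star_eq_adjoint, eq_comm, ContinuousLinearMap.eq_adjoint_iff]
  intro ξ η
  rw [lp.inner_eq_tsum, lp.inner_eq_tsum]
  -- Both inner products are sums over the graph.
  rw [← (Graph.fst_injective f).tsum_eq, ← (Graph.snd_injective f).tsum_eq]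
  · refine tsum_congr fun p => ?_
    rw [toOp_apply, toOp_apply, push_of_mem p.2, push_of_mem (f.mem_iff_mem.mpr p.2)]
  · intro y hy
    refine mem_range_snd_of_push_ne_zero (ξ := η) fun h0 => hy ?_
    simp [toOp_apply, h0]
  · intro x hx
    by_contra hx'
    refine hx ?_
    have h0 : f.symm.push ξ x = 0 :=
      push_of_notMem (fun y hy => hx' ⟨⟨(x, y), f.mem_iff_mem.mp hy⟩, rfl⟩) ξ
    simp [toOp_apply, h0]

open Classical in
theorem toOp_ofSet_apply (V : Set X) (ξ : lp (fun _ : X => ℂ) 2) (x : X) :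
    (ofSet V).toOp ξ x = if x ∈ V then ξ x else 0 := by
  rw [toOp_apply]
  split_ifs with h
  · exact push_of_mem (mem_ofSet_self_iff.mpr h) ξ
  · exact push_of_notMem (fun y hy => h (by simp_all)) ξ

open Classical in
theorem toOp_ofSet_eq_one {V : Set X} (hV : ∀ x, x ∈ V) : (ofSet V).toOp = 1 := by
  ext ξ x
  rw [toOp_ofSet_apply, if_pos (hV x), one_apply_eq_self]

open Classical in
/-- A finite partition of a set gives a decomposition of the corresponding projection. -/
theorem toOp_ofSet_eq_sum {ι : Type*} (t : Finset ι) (V : Set X) (W : ι → Set X)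
    (hV : ∀ x ∈ V, ∃ i ∈ t, ∀ j ∈ t, x ∈ W j ↔ j = i)
    (hW : ∀ i ∈ t, W i ⊆ V) :
    (ofSet V).toOp = ∑ i ∈ t, (ofSet (W i)).toOp := by
  ext ξ x
  rw [sum_apply, lp.coeFn_sum, Finset.sum_apply]
  simp only [toOp_ofSet_apply]
  by_cases hx : x ∈ V
  · obtain ⟨i, hi, h⟩ := hV x hx
    rw [if_pos hx, Finset.sum_eq_single_of_mem i hi, if_pos ((h i hi).mpr rfl)]
    intro j hj hji
    rw [if_neg fun hj' => hji ((h j hj).mp hj')]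
  · rw [if_neg hx, eq_comm]
    exact Finset.sum_eq_zero fun i hi => if_neg fun h => hx (hW i hi h)

open Classical in
theorem toOp_ofSet_ne_zero {V : Set X} (hV : V.Nonempty) : (ofSet V).toOp ≠ 0 := by
  obtain ⟨x, hx⟩ := hV
  intro h
  have h1 := toOp_ofSet_apply V (lp.single 2 x (1 : ℂ)) x
  rw [h, if_pos hx, lp.single_apply_self] at h1
  exact zero_ne_one h1

end PEquiv

/-! ### Initial segments -/

namespace KGraph

variable {k : ℕ∞} {Λ : KGraph.{u} k}

/-- `α` is an initial segment of `ω`. -/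
def IsInitial (α ω : Λ.Path) : Prop := ∃ β, Λ.s α = Λ.r β ∧ Λ.comp α β = ω

namespace IsInitial

theorem refl (α : Λ.Path) : IsInitial α α := ⟨Λ.s α, (Λ.r_s α).symm, Λ.comp_id α⟩

theorem trans {α β γ : Λ.Path} (h : IsInitial α β) (h' : IsInitial β γ) : IsInitial α γ := by
  obtain ⟨δ, h1, rfl⟩ := h
  obtain ⟨ε, h2, rfl⟩ := h'
  rw [Λ.s_comp _ _ h1] at h2
  exact ⟨Λ.comp δ ε, by rw [Λ.r_comp _ _ h2, h1], by rw [Λ.assoc _ _ _ h1 h2]⟩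

theorem r_eq {α ω : Λ.Path} (h : IsInitial α ω) : Λ.r ω = Λ.r α := by
  obtain ⟨β, h1, rfl⟩ := h
  exact Λ.r_comp _ _ h1

theorem eq {α α' ω : Λ.Path} (h : IsInitial α ω) (h' : IsInitial α' ω) (hd : Λ.d α = Λ.d α') :
    α = α' := by
  obtain ⟨β, h1, h2⟩ := h
  obtain ⟨β', h1', h2'⟩ := h'
  exact (comp_cancel h1 h1' hd (h2.trans h2'.symm)).1

theorem exists_of_degree {ω : Λ.Path} {n m : KDegree k} (h : Λ.d ω = n + m) :
    ∃ α, Λ.d α = n ∧ IsInitial α ω := by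
  obtain ⟨α, β, hα, -, hs, he⟩ := exists_comp_eq h
  exact ⟨α, hα, β, hs, he⟩

theorem of_degree {α α' ω : Λ.Path} (h : IsInitial α ω) (h' : IsInitial α' ω) {m : KDegree k}
    (hd : Λ.d α' = Λ.d α + m) : IsInitial α α' := by
  obtain ⟨γ, hγ, hγ'⟩ := exists_of_degree hd
  rwa [(hγ'.trans h').eq h hγ] at hγ'

theorem comp_left {μ α ω : Λ.Path} (h : IsInitial α ω) (hs : Λ.s μ = Λ.r α) :
    IsInitial (Λ.comp μ α) (Λ.comp μ ω) := by
  obtain ⟨β, h1, rfl⟩ := h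
  exact ⟨β, by rw [Λ.s_comp _ _ hs, h1], Λ.assoc _ _ _ hs h1⟩

end IsInitial

/-! ### Infinite paths -/

variable (Λ) in
/-- An infinite path in `Λ`, given by its initial segments of all degrees. -/
@[ext] structure InfinitePath where
  /-- the initial segment of degree `n` -/
  seg : KDegree k → Λ.Path
  d_seg : ∀ n, Λ.d (seg n) = n
  isInitial_add : ∀ n m, IsInitial (seg n) (seg (n + m))

namespace InfinitePath

theorem r_seg (x : Λ.InfinitePath) (n : KDegree k) : Λ.r (x.seg n) = x.seg 0 := by
  have := (x.isInitial_add 0 n).r_eq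
  rwa [zero_add, r_eq_self (x.d_seg 0)] at this

theorem seg_zero_mem (x : Λ.InfinitePath) : x.seg 0 ∈ Λ.vertices := x.d_seg 0

open CategoryTheory in
/-- In a row-finite `k`-graph without sources there is an infinite path starting at each vertex, by
compactness. -/
theorem exists_seg_zero_eq (hrow : Λ.RowFinite) (hsrc : Λ.NoSources) {v : Λ.Path}
    (hv : v ∈ Λ.vertices) : ∃ x : Λ.InfinitePath, x.seg 0 = v := by
  classical
  have hex : ∀ (n m : KDegree k) (_ : n ≤ m) (α : Λ.pathsTo v m),
      ∃ β : Λ.pathsTo v n, IsInitial β.1 α.1 := by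
    intro n m hnm α
    obtain ⟨l, rfl⟩ := exists_add_of_le hnm
    obtain ⟨β, hβ, hβ'⟩ := IsInitial.exists_of_degree α.2.2
    exact ⟨⟨β, by rw [← hβ'.r_eq, α.2.1], hβ⟩, hβ'⟩
  choose p hp using hex
  let F : (KDegree k)ᵒᵖ ⥤ Type u :=
    { obj := fun n => Λ.pathsTo v n.unop
      map := fun f => ↾(p _ _ f.unop.le)
      map_id := fun n => by
        ext α
        exact (hp _ _ _ α).eq (.refl _) ((p _ _ _ α).2.2.trans α.2.2.symm)
      map_comp := fun f g => by
        ext α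
        exact (hp _ _ _ α).eq ((hp _ _ _ _).trans (hp _ _ _ α))
          ((p _ _ _ _).2.2.trans (p _ _ _ _).2.2.symm) }
  have : ∀ n, Finite (F.obj n) := fun n => (hrow v hv n.unop).to_subtype
  have : ∀ n, Nonempty (F.obj n) := fun n => (hsrc v hv n.unop).to_subtype
  obtain ⟨x, hx⟩ := nonempty_sections_of_finite_inverse_system F
  refine ⟨⟨fun n => (x (Opposite.op n)).1, fun n => (x (Opposite.op n)).2.2, fun n m => ?_⟩, ?_⟩
  · have hnm : n ≤ n + m := le_self_add
    have h1 : p _ _ hnm (x (Opposite.op (n + m))) = x (Opposite.op n) := hx (homOfLE hnm).op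
    rw [← h1]
    exact hp _ _ hnm _
  · have h0 := (x (Opposite.op 0)).2
    have h1 := r_eq_self (Λ := Λ) h0.2
    exact h1.symm.trans h0.1

/-- The relation `y = μ x`. -/
def IsComp (μ : Λ.Path) (x y : Λ.InfinitePath) : Prop :=
  Λ.s μ = x.seg 0 ∧ ∀ n, y.seg (Λ.d μ + n) = Λ.comp μ (x.seg n)

namespace IsComp

variable {μ ν : Λ.Path} {x x' y y' : Λ.InfinitePath}

theorem s_eq_r (h : IsComp μ x y) (n : KDegree k) : Λ.s μ = Λ.r (x.seg n) :=
  h.1.trans (x.r_seg n).symm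

theorem seg_d (h : IsComp μ x y) : y.seg (Λ.d μ) = μ := by
  have := h.2 0
  rwa [add_zero, ← h.1, Λ.comp_id] at this

theorem right_unique (h : IsComp μ x y) (h' : IsComp μ x y') : y = y' := by
  ext n
  have h1 := y.isInitial_add n (Λ.d μ)
  have h2 := y'.isInitial_add n (Λ.d μ)
  rw [add_comm n, h.2] at h1
  rw [add_comm n, h'.2] at h2
  exact h1.eq h2 (by rw [y.d_seg, y'.d_seg])

theorem left_unique (h : IsComp μ x y) (h' : IsComp μ x' y) : x = x' := by
  ext n
  exact (comp_cancel (h.s_eq_r n) (h'.s_eq_r n) rfl ((h.2 n).symm.trans (h'.2 n))).2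

theorem exists_right (μ : Λ.Path) (x : Λ.InfinitePath) (hs : Λ.s μ = x.seg 0) :
    ∃ y, IsComp μ x y := by
  have hsr : ∀ n, Λ.s μ = Λ.r (x.seg n) := fun n => hs.trans (x.r_seg n).symm
  have hd : ∀ n, Λ.d (Λ.comp μ (x.seg n)) = Λ.d μ + n := fun n => by
    rw [Λ.d_comp _ _ (hsr n), x.d_seg]
  have hini : ∀ n m, IsInitial (Λ.comp μ (x.seg n)) (Λ.comp μ (x.seg (n + m))) := fun n m =>
    (x.isInitial_add n m).comp_left (hsr n)
  choose y hyd hy using fun n => IsInitial.exists_of_degree ((hd n).trans (add_comm _ _))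
  refine ⟨⟨y, hyd, fun n m => ?_⟩, hs, fun n => ?_⟩
  · exact ((hy n).trans (hini n m)).of_degree (hy (n + m)) (by rw [hyd, hyd])
  · refine (hy (Λ.d μ + n)).eq ?_ (by rw [hyd, hd])
    rw [add_comm (Λ.d μ)]
    exact hini n _

theorem exists_left (μ : Λ.Path) (y : Λ.InfinitePath) (hμ : y.seg (Λ.d μ) = μ) :
    ∃ x, IsComp μ x y := by
  have hini : ∀ n, ∃ β, Λ.s μ = Λ.r β ∧ Λ.comp μ β = y.seg (Λ.d μ + n) := fun n => by
    have := y.isInitial_add (Λ.d μ) n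
    rwa [hμ] at this
  choose x hxs hx using hini
  have hxd : ∀ n, Λ.d (x n) = n := fun n => by
    have := y.d_seg (Λ.d μ + n)
    rw [← hx n, Λ.d_comp _ _ (hxs n)] at this
    exact add_left_cancel this
  refine ⟨⟨x, hxd, fun n m => ?_⟩, ?_, fun n => (hx n).symm⟩
  · obtain ⟨β, hβ, hβ'⟩ := y.isInitial_add (Λ.d μ + n) m
    rw [← hx n, Λ.s_comp _ _ (hxs n)] at hβ
    rw [← hx n, Λ.assoc _ _ _ (hxs n) hβ, add_assoc, ← hx] at hβ'
    exact ⟨β, hβ, (comp_cancel ((hxs n).trans (Λ.r_comp _ _ hβ).symm) (hxs _) rfl hβ').2⟩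
  · exact (hxs 0).trans (r_eq_self (hxd 0))

theorem comp_iff (hs : Λ.s μ = Λ.r ν) :
    IsComp (Λ.comp μ ν) x y ↔ ∃ w, IsComp ν x w ∧ IsComp μ w y := by
  constructor
  · rintro ⟨h1, h2⟩
    rw [Λ.s_comp _ _ hs] at h1
    obtain ⟨w, hw⟩ := exists_right ν x h1
    obtain ⟨z, hz⟩ := exists_right μ w (by
      have := w.r_seg (Λ.d ν)
      rw [← this, hw.seg_d, hs])
    refine ⟨w, hw, ?_⟩
    have : IsComp (Λ.comp μ ν) x z := by
      refine ⟨by rw [Λ.s_comp _ _ hs, h1], fun n => ?_⟩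
      rw [Λ.d_comp _ _ hs, add_assoc, hz.2, hw.2, Λ.assoc _ _ _ hs (hw.s_eq_r n)]
    rwa [right_unique ⟨by rw [Λ.s_comp _ _ hs, h1], h2⟩ this]
  · rintro ⟨w, hw, hz⟩
    refine ⟨by rw [Λ.s_comp _ _ hs, hw.1], fun n => ?_⟩
    rw [Λ.d_comp _ _ hs, add_assoc, hz.2, hw.2, Λ.assoc _ _ _ hs (hw.s_eq_r n)]

theorem vertex_iff {v : Λ.Path} (hv : v ∈ Λ.vertices) : IsComp v x y ↔ x = y ∧ x.seg 0 = v := by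
  have hid : x.seg 0 = v → IsComp v x x := fun h => by
    refine ⟨by rw [s_eq_self hv, h], fun n => ?_⟩
    rw [show Λ.d v = 0 from hv, zero_add]
    conv_rhs => rw [← h, ← x.r_seg n, Λ.id_comp]
  constructor
  · intro h
    have h0 : x.seg 0 = v := by rw [← h.1, s_eq_self hv]
    exact ⟨right_unique (hid h0) h, h0⟩
  · rintro ⟨rfl, h⟩
    exact hid h

end IsComp

/-- The partial bijection `x ↦ μ x` of the space of infinite paths. -/
def shift (μ : Λ.Path) : Λ.InfinitePath ≃. Λ.InfinitePath :=
  PEquiv.ofRel (IsComp μ) (fun _ _ _ => IsComp.right_unique) fun _ _ _ => IsComp.left_unique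

theorem mem_shift {μ : Λ.Path} {x y : Λ.InfinitePath} : y ∈ shift μ x ↔ IsComp μ x y :=
  PEquiv.mem_ofRel

theorem shift_comp {μ ν : Λ.Path} (hs : Λ.s μ = Λ.r ν) :
    shift (Λ.comp μ ν) = (shift ν).trans (shift μ) :=
  PEquiv.ext fun x => Option.ext fun y => by
    rw [← Option.mem_def, ← Option.mem_def, mem_shift, PEquiv.mem_trans, IsComp.comp_iff hs]
    simp only [mem_shift]

open Classical in
theorem shift_vertex {v : Λ.Path} (hv : v ∈ Λ.vertices) :
    shift v = PEquiv.ofSet {x : Λ.InfinitePath | x.seg 0 = v} :=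
  PEquiv.ext fun x => Option.ext fun y => by
    rw [← Option.mem_def, ← Option.mem_def, mem_shift, IsComp.vertex_iff hv, PEquiv.mem_ofSet_iff]
    constructor <;> (rintro ⟨rfl, h⟩; exact ⟨rfl, h⟩)

theorem shift_trans_symm (μ : Λ.Path) : (shift μ).trans (shift μ).symm = shift (Λ.s μ) :=
  PEquiv.ext fun x => Option.ext fun y => by
    rw [← Option.mem_def, ← Option.mem_def, mem_shift, IsComp.vertex_iff (Λ.s_mem_vertices μ),
      PEquiv.mem_trans]
    simp only [PEquiv.mem_iff_mem, mem_shift]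
    constructor
    · rintro ⟨w, hx, hy⟩
      exact ⟨hx.left_unique hy, hx.1.symm⟩
    · rintro ⟨rfl, hx⟩
      obtain ⟨w, hw⟩ := IsComp.exists_right μ x hx.symm
      exact ⟨w, hw, hw⟩

open Classical in
theorem symm_trans_shift (μ : Λ.Path) :
    (shift μ).symm.trans (shift μ) = PEquiv.ofSet {x : Λ.InfinitePath | x.seg (Λ.d μ) = μ} :=
  PEquiv.ext fun x => Option.ext fun y => by
    rw [← Option.mem_def, ← Option.mem_def, PEquiv.mem_trans, PEquiv.mem_ofSet_iff]
    simp only [PEquiv.mem_iff_mem, mem_shift]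
    constructor
    · rintro ⟨w, hx, hy⟩
      exact ⟨hy.right_unique hx, hy.seg_d⟩
    · rintro ⟨rfl, hx⟩
      obtain ⟨w, hw⟩ := IsComp.exists_left μ y hx
      exact ⟨w, hw, hw⟩

/-- The Cuntz-Krieger family of a `k`-graph on the Hilbert space of its infinite paths. -/
theorem isCK_toOp_shift (hΛ : Λ.RowFinite) :
    IsCuntzKriegerFamily Λ fun μ => (shift μ).toOp := by
  classical
  have hmul : ∀ μ ν, Λ.s μ = Λ.r ν →
      (shift (Λ.comp μ ν)).toOp = (shift μ).toOp * (shift ν).toOp := fun μ ν hs => by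
    rw [shift_comp hs, PEquiv.toOp_trans]
  have hsms : ∀ μ : Λ.Path, star (shift μ).toOp * (shift μ).toOp = (shift (Λ.s μ)).toOp :=
    fun μ => by rw [PEquiv.star_toOp, ← PEquiv.toOp_trans, shift_trans_symm]
  have hmss : ∀ μ : Λ.Path, (shift μ).toOp * star (shift μ).toOp =
      (PEquiv.ofSet {x : Λ.InfinitePath | x.seg (Λ.d μ) = μ}).toOp :=
    fun μ => by rw [PEquiv.star_toOp, ← PEquiv.toOp_trans, symm_trans_shift]
  refine ⟨fun μ => ?_, fun v hv => ⟨?_, ?_⟩, fun v hv w hw hne => ?_, hmul, hsms,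
    fun v hv n => ?_⟩
  · rw [mul_assoc, hsms, ← hmul _ _ (Λ.r_s μ).symm, Λ.comp_id]
  · have h1 := Λ.comp_id v
    rw [s_eq_self hv] at h1
    rw [IsIdempotentElem, ← hmul v v (by rw [s_eq_self hv, r_eq_self hv]), h1]
  · rw [isSelfAdjoint_iff, PEquiv.star_toOp, shift_vertex hv, PEquiv.ofSet_symm]
  · rw [shift_vertex hv, shift_vertex hw]
    ext ξ x
    rw [mul_apply_eq_comp, PEquiv.toOp_ofSet_apply, PEquiv.toOp_ofSet_apply]
    simp only [Set.mem_ofPred_eq, zero_apply, lp.coeFn_zero, Pi.zero_apply]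
    split_ifs with h1 h2
    · exact absurd (h1.symm.trans h2) hne
    · rfl
    · rfl
  · simp only [hmss]
    rw [finsum_mem_eq_finite_toFinset_sum _ (hΛ v hv n), shift_vertex hv]
    refine PEquiv.toOp_ofSet_eq_sum _ _ _
      (fun x hx => ⟨x.seg n, ?_, fun μ hμ => ?_⟩) fun μ hμ x hx => ?_
    · rw [Set.Finite.mem_toFinset]
      exact ⟨(x.r_seg n).trans hx, x.d_seg n⟩
    · rw [Set.Finite.mem_toFinset] at hμ
      rw [Set.mem_ofPred_eq, hμ.2, eq_comm]
    · rw [Set.Finite.mem_toFinset] at hμ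
      rw [Set.mem_ofPred_eq, ← x.r_seg (Λ.d μ), show x.seg (Λ.d μ) = μ from hx, hμ.1]

end InfinitePath

end KGraph
/-! ### The self-similar family on infinite paths -/

namespace SelfSimilarAction

open KGraph

variable {k : ℕ∞} {G : Type u} [Group G] {Λ : KGraph.{u} k} (a : SelfSimilarAction G Λ)

theorem s_act_eq (g : G) (μ : Λ.Path) :
    Λ.s (a.act g μ) = a.act (a.restr g μ) (Λ.s μ) := by
  rw [a.composable g μ (Λ.s μ) (Λ.r_s μ).symm, a.r_act, Λ.r_s]

theorem isInitial_act (g : G) {α ω : Λ.Path} (h : IsInitial α ω) :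
    IsInitial (a.act g α) (a.act g ω) := by
  obtain ⟨β, hs, rfl⟩ := h
  exact ⟨_, a.composable g α β hs, (a.act_comp g α β hs).symm⟩

/-- The action on infinite paths. -/
def actInfinite : G →* Equiv.Perm Λ.InfinitePath :=
  MonoidHom.toHomPerm
    { toFun := fun g x => ⟨fun n => a.act g (x.seg n), fun n => by rw [a.d_act, x.d_seg],
        fun n m => a.isInitial_act g (x.isInitial_add n m)⟩
      map_one' := funext fun x => InfinitePath.ext (funext fun n => by
        change a.act 1 (x.seg n) = x.seg n
        rw [map_one, Equiv.Perm.one_apply])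
      map_mul' := fun g h => funext fun x => InfinitePath.ext (funext fun n => by
        change a.act (g * h) (x.seg n) = a.act g (a.act h (x.seg n))
        rw [map_mul, Equiv.Perm.mul_apply]) }

theorem seg_actInfinite (g : G) (x : Λ.InfinitePath) (n : KDegree k) :
    (a.actInfinite g x).seg n = a.act g (x.seg n) := rfl

/-- `g (μ x) = (g μ) (g|_μ x)`. -/
theorem isComp_actInfinite (g : G) {μ : Λ.Path} {x y : Λ.InfinitePath}
    (h : InfinitePath.IsComp μ x y) :
    InfinitePath.IsComp (a.act g μ) (a.actInfinite (a.restr g μ) x) (a.actInfinite g y) := by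
  refine ⟨?_, fun n => ?_⟩
  · rw [s_act_eq, h.1, seg_actInfinite]
  · rw [seg_actInfinite, a.d_act, h.2, a.act_comp _ _ _ (h.s_eq_r n), seg_actInfinite]

theorem shift_trans_actInfinite (g : G) (μ : Λ.Path) :
    (InfinitePath.shift μ).trans (a.actInfinite g).toPEquiv =
      (a.actInfinite (a.restr g μ)).toPEquiv.trans (InfinitePath.shift (a.act g μ)) :=
  PEquiv.ext fun x => Option.ext fun z => by
    rw [← Option.mem_def, ← Option.mem_def, PEquiv.mem_trans, PEquiv.mem_trans]
    simp only [InfinitePath.mem_shift, Equiv.toPEquiv_apply, Option.mem_some_iff]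
    constructor
    · rintro ⟨y, hy, rfl⟩
      exact ⟨_, rfl, a.isComp_actInfinite g hy⟩
    · rintro ⟨_, rfl, hz⟩
      have hs : Λ.s μ = x.seg 0 := by
        have := hz.1
        rw [s_act_eq, seg_actInfinite] at this
        exact (a.act _).injective this
      obtain ⟨y, hy⟩ := InfinitePath.IsComp.exists_right μ x hs
      exact ⟨y, hy, (a.isComp_actInfinite g hy).right_unique hz⟩

/-- The representation of a self-similar action on the Hilbert space of infinite paths. -/
theorem isSelfSimilarFamily_infinitePath (hΛ : Λ.RowFinite) (hfin : Λ.vertices.Finite) :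
    IsSelfSimilarFamily a (fun g => (a.actInfinite g).toPEquiv.toOp)
      fun μ : Λ.Path => (InfinitePath.shift μ).toOp := by
  classical
  refine ⟨InfinitePath.isCK_toOp_shift hΛ, ?_, fun g => ⟨?_, ?_⟩, fun g h => ?_, fun g μ => ?_⟩
  · rw [finsum_mem_eq_finite_toFinset_sum _ hfin, ← PEquiv.toOp_ofSet_eq_one Set.mem_univ,
      PEquiv.toOp_ofSet_eq_sum hfin.toFinset Set.univ fun v => {x : Λ.InfinitePath | x.seg 0 = v}]
    · refine Finset.sum_congr rfl fun v hv => ?_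
      rw [InfinitePath.shift_vertex (hfin.mem_toFinset.mp hv)]
    · exact fun x _ => ⟨x.seg 0, hfin.mem_toFinset.mpr x.seg_zero_mem, fun v _ => eq_comm⟩
    · exact fun _ _ => Set.subset_univ _
  · rw [PEquiv.star_toOp, ← PEquiv.toOp_trans, ← Equiv.toPEquiv_symm, ← Equiv.toPEquiv_trans,
      Equiv.self_trans_symm, Equiv.toPEquiv_refl, PEquiv.toOp_refl]
  · rw [PEquiv.star_toOp, ← PEquiv.toOp_trans, ← Equiv.toPEquiv_symm, ← Equiv.toPEquiv_trans,
      Equiv.symm_trans_self, Equiv.toPEquiv_refl, PEquiv.toOp_refl]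
  · rw [map_mul, ← PEquiv.toOp_trans, ← Equiv.toPEquiv_trans]
    rfl
  · rw [← PEquiv.toOp_trans, ← PEquiv.toOp_trans, shift_trans_actInfinite]

/-- No vertex projection vanishes in `O_{G,Λ}`, since each vertex is the range of some infinite
path. -/
theorem sGen_ne_zero (hrow : Λ.RowFinite) (hsrc : Λ.NoSources) (hfin : Λ.vertices.Finite)
    {v : Λ.Path} (hv : v ∈ Λ.vertices) : a.sGen v ≠ 0 := by
  classical
  intro h0
  let F : a.Family := ⟨_, _, _, a.isSelfSimilarFamily_infinitePath hrow hfin⟩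
  have h1 : (InfinitePath.shift v).toOp = 0 := (congrArg (a.eval F) h0).trans (map_zero (a.eval F))
  rw [InfinitePath.shift_vertex hv] at h1
  exact PEquiv.toOp_ofSet_ne_zero (InfinitePath.exists_seg_zero_eq hrow hsrc hv) h1

end SelfSimilarAction

/-! ### Gauge actions -/

/-- The action preserves degrees, so the relation between `U` and `S` survives a gauge twist. -/
theorem IsSelfSimilarFamily.twist {k : ℕ∞} {G : Type u} [Group G] {Λ : KGraph.{u} k}
    {a : SelfSimilarAction G Λ} {B : Type*} [CStarAlgebra B] {U : G → B} {S : Λ.Path → B}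
    (h : IsSelfSimilarFamily a U S) (z : Torus k) :
    IsSelfSimilarFamily a U fun μ => (Torus.monomial z (Λ.d μ) : ℂ) • S μ where
  cuntzKrieger := h.cuntzKrieger.twist z
  sum_vertices := by
    rw [← h.sum_vertices]
    refine finsum_mem_congr rfl fun v hv => ?_
    rw [show Λ.d v = 0 from hv, Torus.monomial_zero, Circle.coe_one, one_smul]
  unitary := h.unitary
  mul := h.mul
  covariant g μ := by rw [mul_smul_comm, h.covariant, a.d_act, smul_mul_assoc]

/-- The gauge action on `O_Λ`: the twist by a character permutes the Cuntz-Krieger families over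
which the defining product is taken. -/
theorem KGraph.exists_gauge {k : ℕ∞} (Λ : KGraph.{u} k) (z : Torus k) :
    ∃ γ : Λ.CKAlgebra →⋆ₙₐ[ℂ] Λ.CKAlgebra,
      ∀ μ, γ (Λ.ckGen μ) = (Torus.monomial z (Λ.d μ) : ℂ) • Λ.ckGen μ :=
  ProductFamily.exists_hom
    (fun i : Λ.CKFamily => ProductFamily.eval (fun i : Λ.CKFamily => i.S)
      (fun i => i.isCK.norm_le_one) ⟨i.B, _, i.isCK.twist z⟩)
    (fun μ => (Torus.monomial z (Λ.d μ) : ℂ) • Λ.ckGen μ) fun _ _ => rfl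

/-- The gauge action on `O_{G,Λ}`, which fixes the unitaries `u_g`. -/
theorem SelfSimilarAction.exists_gauge {k : ℕ∞} {G : Type u} [Group G] {Λ : KGraph.{u} k}
    (a : SelfSimilarAction G Λ) (z : Torus k) :
    ∃ δ : a.UnivAlgebra →⋆ₙₐ[ℂ] a.UnivAlgebra,
      ∀ μ, δ (a.sGen μ) = (Torus.monomial z (Λ.d μ) : ℂ) • a.sGen μ := by
  obtain ⟨δ, hδ⟩ := ProductFamily.exists_hom
    (fun i : a.Family => ProductFamily.eval (fun i : a.Family => Sum.elim i.U i.S)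
      (fun i => i.isFamily.norm_le_one) ⟨i.B, i.U, _, i.isFamily.twist z⟩)
    (Sum.elim a.uGen fun μ => (Torus.monomial z (Λ.d μ) : ℂ) • a.sGen μ)
    (by rintro _ (g | μ) <;> rfl)
  exact ⟨δ, fun μ => hδ (Sum.inr μ)⟩

theorem SelfSimilarAction.exists_ckHom {k : ℕ∞} {G : Type u} [Group G] {Λ : KGraph.{u} k}
    (a : SelfSimilarAction G Λ) :
    ∃ ι : Λ.CKAlgebra →⋆ₙₐ[ℂ] a.UnivAlgebra, ∀ μ, ι (Λ.ckGen μ) = a.sGen μ :=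
  ProductFamily.exists_hom
    (fun i : a.Family => ProductFamily.eval (fun i : Λ.CKFamily => i.S)
      (fun i => i.isCK.norm_le_one) ⟨i.B, i.S, i.isFamily.cuntzKrieger⟩)
    a.sGen fun _ _ => rfl
end

theorem mainTheorem9 {k : ℕ∞} (hk : 1 ≤ k) {G : Type u} [Group G] [Countable G]
    (Λ : KGraph.{u} k) (hrow : Λ.RowFinite) (hsrc : Λ.NoSources) (hfin : Λ.vertices.Finite)
    (a : SelfSimilarAction G Λ) :
    ∃ ι : Λ.CKAlgebra →⋆ₙₐ[ℂ] a.UnivAlgebra,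
      (∀ μ, ι (Λ.ckGen μ) = a.sGen μ) ∧
      (∀ ι' : Λ.CKAlgebra →⋆ₙₐ[ℂ] a.UnivAlgebra, (∀ μ, ι' (Λ.ckGen μ) = a.sGen μ) → ι' = ι) ∧
      Function.Injective ι := by
  obtain ⟨ι, hι⟩ := a.exists_ckHom
  choose γ hγ using Λ.exists_gauge
  choose δ hδ using a.exists_gauge
  refine ⟨ι, hι, fun ι' hι' => ProductFamily.hom_ext fun μ => (hι' μ).trans (hι μ).symm, ?_⟩
  have hcomm : ∀ z, ι.comp (γ z) = (δ z).comp ι := fun z => ProductFamily.hom_ext fun μ => by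
    change ι (γ z (Λ.ckGen μ)) = δ z (ι (Λ.ckGen μ))
    rw [hγ, map_smul, hι, hδ]
  refine (Λ.isCK_ckGen hrow).injective_of_gauge_invariant hrow hfin
    ProductFamily.mem_closure_adjoin_gen hγ ι (fun v hv => ?_) fun z x hx => ?_
  · rw [hι]
    exact a.sGen_ne_zero hrow hsrc hfin hv
  · have := DFunLike.congr_fun (hcomm z) x
    change ι (γ z x) = δ z (ι x) at this
    rw [this, hx, map_zero]
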